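/- Let $K=\mathbb{Q}(i)$ with ring of integers $\mathcal{O}_K=\mathbb{Z}[i]$. Let $D\in\mathcal{O}_K$ be quartic-free (not divisible by the fourth power of any prime of $\mathcal{O}_K$) with $D\equiv 1 \bmod (2+2i)$, and let $E_{-D}$ be the elliptic curve $y^2=x^3+Dx$ over $K$. Let $\psi=\psi_{-D}$ be the Hecke character of $K$ associated to $E_{-D}$: for a prime $\mathfrak{p}$ of good reduction, $\psi(\mathfrak{p})\in\mathcal{O}_K=\mathrm{End}(E_{-D})$ is the endomorphism that reduces modulo $\mathfrak{p}$ to the Frobenius (with $[i](x,y)=(-x,iy)$), and $\psi(\mathfrak{p})=0$ for a prime $\mathfrak{p}$ of bad reduction. Let $L(\overline{\psi},s)$ be the analytically continued Hecke $L$-function with Euler product $\prod_{\mathfrak{p}}(1-\overline{\psi}(\mathfrak{p})N\mathfrak{p}^{-s})^{-1}$, and for $0\neq g\in\mathcal{O}_K$ put $$L_g(\overline{\psi},s)=L(\overline{\psi},s)\prod_{\mathfrak{p}\mid g\mathcal{O}_K}\left(1-\frac{\overline{\psi}(\mathfrak{p})}{N\mathfrak{p}^{s}}\right).$$ Let $\Omega=\int_1^\infty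 \frac{dx}{\sqrt{x^3-x}}$, let $(\cdot/\cdot)_4$ be the quartic residue symbol of $\mathcal{O}_K$, and let $v_2$ be the $2$-adic valuation with $v_2(2)=1$ and $v_2(0)=\infty$, transported to complex numbers by any fixed field embedding $\mathbb{C}\hookrightarrow\mathbb{C}_2$ into the completion of an algebraic closure of $\mathbb{Q}_2$. Then: 1. $E_{-D}$ has bad reduction at every prime of $\mathcal{O}_K$ dividing $D\mathcal{O}_K$. 2. $E_{-D}$ has good reduction at the prime $(1+i)\mathcal{O}_K$ if and only if $(i/D)_4=i$. 3. One has $$v_2\left(\frac{L_{2D}(\overline{\psi},1)}{\Omega}\right)=v_2\left(\frac{L_{2}(\overline{\psi},1)}{\Omega}\right)=\begin{cases} v_2\left(\dfrac{L(\overline{\psi},1)}{\Omega}\right)-\dfrac12 & \text{if } (i/D)_4=i,\\[2ex] v_2\left(\dfrac{L(\overline{\psi},1)}{\Omega}\right) & \text{otherwise.}\end{cases}$$ -/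

import Mathlib

open IsDedekindDomain

noncomputable section

namespace GaussCurve

/-- The field `K = ℚ(i)`, the fraction field of the ring of integers `ℤ[i]`. -/
abbrev K : Type := FractionRing GaussianInt

/-- The element `i` of `ℤ[i]`. -/
def gi : GaussianInt := ⟨0, 1⟩

/-- The nonzero prime ideals of `ℤ[i]`. -/
abbrev Place : Type := HeightOneSpectrum GaussianInt

theorem prime_one_add_i : Prime (⟨1, 1⟩ : GaussianInt) := by
  rw [← irreducible_iff_prime]
  have hu : ∀ a : GaussianInt, a.norm.natAbs = 1 → IsUnit a := fun a h =>
    Zsqrtd.norm_eq_one_iff.1 h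
  refine ⟨fun h => ?_, fun a b hab => ?_⟩
  · have := Zsqrtd.norm_eq_one_iff.2 h
    revert this
    decide
  · have h : a.norm.natAbs * b.norm.natAbs = 2 := by
      rw [← Int.natAbs_mul, ← Zsqrtd.norm_mul, ← hab]
      decide
    have h2 : a.norm.natAbs ∣ 2 := Dvd.intro _ h
    rcases (Nat.dvd_prime Nat.prime_two).1 h2 with h1 | h1
    · exact Or.inl (hu a h1)
    · refine Or.inr (hu b ?_)
      rw [h1] at h
      omega

/-- The prime `(1 + i)ℤ[i]`. -/
def placeTwo : Place where
  asIdeal := Ideal.span {(⟨1, 1⟩ : GaussianInt)}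
  isPrime := (Ideal.span_singleton_prime prime_one_add_i.ne_zero).2 prime_one_add_i
  ne_bot := by
    rw [Ne, Ideal.span_singleton_eq_bot]
    exact prime_one_add_i.ne_zero

/-! ### The curve and its reduction -/

/-- The elliptic curve `E_{-D} : y² = x³ + D x` over `K`. -/
def curve (D : GaussianInt) : WeierstrassCurve K :=
  ⟨0, 0, 0, algebraMap GaussianInt K D, 0⟩

/-- The local ring of `K` at `𝔭`: the localization of `ℤ[i]` at `𝔭`, inside `K`. -/
abbrev LocalRingAt (𝔭 : Place) : Type :=
  HeightOneSpectrum.valuationSubringAtPrime K 𝔭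

instance (𝔭 : Place) : IsDiscreteValuationRing (LocalRingAt 𝔭) :=
  IsLocalization.AtPrime.isDiscreteValuationRing_of_dedekind_domain GaussianInt
    (P := 𝔭.asIdeal) 𝔭.ne_bot (LocalRingAt 𝔭)

/-- `E` has good reduction at `𝔭`: a minimal Weierstrass equation of `E` at `𝔭` has unit
discriminant. Bad reduction is the negation. -/
def HasGoodReductionAt (𝔭 : Place) (E : WeierstrassCurve K) : Prop :=
  (E.minimal (LocalRingAt 𝔭)).HasGoodReduction (LocalRingAt 𝔭)

/-! ### The quartic residue symbol -/

open scoped Classical in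
/-- The quartic residue symbol `(α/π)₄` for a prime `π` not dividing `2`: it is `0` if `π ∣ α`, and
otherwise the unit `u` of `ℤ[i]` with `α ^ ((N π - 1) / 4) ≡ u mod π`. -/
def quarticSymbolPrime (α π : GaussianInt) : GaussianInt :=
  let β := α ^ ((Zsqrtd.norm π).natAbs.pred / 4)
  if π ∣ β - 1 then 1
  else if π ∣ β + 1 then -1
  else if π ∣ β - gi then gi
  else if π ∣ β + gi then -gi
  else 0

/-- The quartic residue symbol `(α/D)₄` for `D` coprime to `2`, extended multiplicatively in `D`
(the factor at a prime `π` depends only on the ideal `(π)`, and `(α/D)₄ = 1` for a unit `D`). -/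
def quarticSymbol (α D : GaussianInt) : GaussianInt :=
  ((UniqueFactorizationMonoid.factors D).map (quarticSymbolPrime α)).prod

/-! ### The Hecke character of `E_{-D}` -/

/-- The automorphism `[i] : (x, y) ↦ (-x, i y)` of `E_{-D}`, as the change of variables
`(x, y) ↦ (u² x, u³ y)` with `u = -i`. It acts on `dx / y` as multiplication by `i`. -/
def cmI : WeierstrassCurve.VariableChange K where
  u := Units.mkOfMulEqOne (algebraMap GaussianInt K (-gi)) (algebraMap GaussianInt K gi) (by
    rw [← map_mul, ← map_one (algebraMap GaussianInt K)]
    congr 1)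
  r := 0
  s := 0
  t := 0

/-- The norm of `𝔭`. -/
def placeNorm (𝔭 : Place) : ℕ := Nat.card (GaussianInt ⧸ 𝔭.asIdeal)

open scoped Classical in
/-- `α = a + b i ∈ ℤ[i] = End(E_{-D})` reduces modulo `𝔭` to the Frobenius endomorphism.

Here `W` is a model of `E_{-D}` over the local ring at `𝔭` with good reduction, isomorphic to
`E_{-D}` through `C`, and `A` is the automorphism of `W` that corresponds to `[i]`. On the points of
the reduction of `W` over an algebraic closure of the residue field, the Frobenius
`(x, y) ↦ (x ^ N𝔭, y ^ N𝔭)` has to equal `a + b A`. (The two nonsingularity conditions under the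
existential quantifier hold automatically.) -/
def ReducesToFrobenius (D : GaussianInt) (𝔭 : Place) (α : GaussianInt) : Prop :=
  ∃ (C : WeierstrassCurve.VariableChange K) (W : WeierstrassCurve (LocalRingAt 𝔭))
    (A : WeierstrassCurve.VariableChange (LocalRingAt 𝔭)),
    W.baseChange K = C • curve D ∧ IsUnit W.Δ ∧ A.baseChange K = C * cmI * C⁻¹ ∧
    let k := AlgebraicClosure (IsLocalRing.ResidueField (LocalRingAt 𝔭))
    let Wk : WeierstrassCurve.Affine k := (W.baseChange k).toAffine
    let B : WeierstrassCurve.VariableChange k := A.baseChange k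
    ∀ (x y : k) (h : Wk.Nonsingular x y),
      ∃ (h₁ : Wk.Nonsingular (x ^ placeNorm 𝔭) (y ^ placeNorm 𝔭))
        (h₂ : Wk.Nonsingular ((B.u : k) ^ 2 * x + B.r)
          ((B.u : k) ^ 3 * y + (B.u : k) ^ 2 * B.s * x + B.t)),
        WeierstrassCurve.Affine.Point.some _ _ h₁ =
          α.re • WeierstrassCurve.Affine.Point.some _ _ h +
            α.im • WeierstrassCurve.Affine.Point.some _ _ h₂

open scoped Classical in
/-- The Hecke character `ψ_{-D}` of `E_{-D}` on prime ideals: at a prime of good reduction it is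
the element of `ℤ[i] = End(E_{-D})` that reduces to the Frobenius (which exists and is unique),
and it is `0` at the primes of bad reduction. -/
def heckeChar (D : GaussianInt) (𝔭 : Place) : GaussianInt :=
  if HasGoodReductionAt 𝔭 (curve D) then Classical.epsilon (ReducesToFrobenius D 𝔭) else 0

/-! ### The Hecke `L`-function -/

/-- The Euler factor polynomial `1 - ψ̄_{-D}(𝔭) N𝔭⁻ˢ`. -/
def eulerFactor (D : GaussianInt) (𝔭 : Place) (s : ℂ) : ℂ :=
  1 - (starRingEnd ℂ) (GaussianInt.toComplex (heckeChar D 𝔭)) * (placeNorm 𝔭 : ℂ) ^ (-s)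

/-- `L` is the Hecke `L`-function of `ψ̄_{-D}`: the entire function given by the Euler product on
the half plane of absolute convergence. -/
structure IsHeckeLFunction (D : GaussianInt) (L : ℂ → ℂ) : Prop where
  entire : Differentiable ℂ L
  eulerProduct : ∀ s : ℂ, 3 / 2 < s.re → HasProd (fun 𝔭 : Place => (eulerFactor D 𝔭 s)⁻¹) (L s)

/-- The Hecke `L`-function `L(ψ̄_{-D}, s)`, by analytic continuation. -/
def heckeL (D : GaussianInt) : ℂ → ℂ := Classical.epsilon (IsHeckeLFunction D)

/-- `L_g(ψ̄_{-D}, s)`: the Hecke `L`-function without the Euler factors at the primes dividing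
`g ≠ 0`, that is, `L(ψ̄_{-D}, s)` times the product of `1 - ψ̄_{-D}(𝔭) N𝔭⁻ˢ` over `𝔭 ∣ g`. -/
def heckeLOmit (g D : GaussianInt) (s : ℂ) : ℂ :=
  heckeL D s * ∏ᶠ (𝔭 : Place) (_ : g ∈ 𝔭.asIdeal), eulerFactor D 𝔭 s

/-- The period `Ω = ∫_1^∞ dx / √(x³ - x) = 2.622…`. -/
def Omega : ℝ := ∫ x in Set.Ioi (1 : ℝ), 1 / √(x ^ 3 - x)

/-- The `2`-adic valuation on `ℂ₂`, the completion of an algebraic closure of `ℚ₂`, normalized by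
`v₂(2) = 1`, with `v₂(0) = ∞`. -/
def v2 (x : ℂ_[2]) : EReal :=
  open scoped Classical in if x = 0 then ⊤ else ((-Real.logb 2 ‖x‖ : ℝ) : EReal)

end GaussCurve

end

namespace GaussCurve

/-! ### Arithmetic of the Gaussian integers modulo powers of `1 + i` -/

/-! The curve has discriminant `-64 D³`, so a model obtained with scaling factor `u` and having unit
discriminant forces `u¹² ~ 64 D³`. At a prime dividing `D`, which is odd, this makes the valuation
of `D` a positive multiple of 4, contrary to quartic-freeness (`not_hasGoodReductionAt_of_mem`).

At `1 + i` it forces `u = (1 + i) ε` with `ε` a unit. The remaining parameters `r, s, t` of the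
change of variables are then integral, and integrality of `a₂, a₄, a₆` becomes congruences modulo 2,
4, 8. These force `D ≡ -1 ± 2i mod 8` (`coords_of_model`), and in those two classes explicit models
exist (`exists_reducesToFrobenius`). The supplementary law `(i/D)₄ = i ^ ((N D - 1)/4)` identifies
the same classes with `(i/D)₄ = i`.

For the valuations, `L` enters only as a common factor. Euler factors at bad primes are 1, so
omitting the primes of `D` changes nothing, and omitting `1 + i` matters only when reduction there
is good. The reduction is then a supersingular curve `y² + y = cubic` over the field with two
elements, whose Frobenius satisfies `F⁸ = 16`. Hence `ψ` has norm 2 (`norm_eq_two_of_frobenius_eq`),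
so `ψ = ±1 ± i`, and `1 - ψ̄/2` has 2-adic valuation `1/2 - 1 = -1/2`. -/

theorem one_add_i_dvd_iff (g : GaussianInt) :
    (⟨1, 1⟩ : GaussianInt) ∣ g ↔ (g.re + g.im) % 2 = 0 := by
  constructor
  · rintro ⟨c, rfl⟩
    simp only [Zsqrtd.re_mul, Zsqrtd.im_mul]
    omega
  · intro h
    refine ⟨⟨(g.re + g.im) / 2, (g.im - g.re) / 2⟩, ?_⟩
    ext <;> simp only [Zsqrtd.re_mul, Zsqrtd.im_mul] <;> omega

theorem natAbs_norm_mod_four {g : GaussianInt} (hg : ¬ (⟨1, 1⟩ : GaussianInt) ∣ g) :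
    g.norm.natAbs % 4 = 1 := by
  rw [one_add_i_dvd_iff] at hg
  have h : g.norm % 4 = 1 := by
    rw [Zsqrtd.norm_def]
    rcases Int.even_or_odd' g.re with ⟨a, ha | ha⟩ <;>
      rcases Int.even_or_odd' g.im with ⟨b, hb | hb⟩ <;> rw [ha, hb] at hg ⊢ <;>
      ring_nf at hg ⊢ <;> omega
  have := GaussianInt.norm_nonneg g
  omega

theorem gi_pow_mod_four (n : ℕ) : gi ^ (n % 4) = gi ^ n := by
  have h4 : gi ^ 4 = 1 := by decide
  conv_rhs => rw [← Nat.div_add_mod n 4, pow_add, pow_mul, h4, one_pow, one_mul]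

theorem gi_pow_eq_gi_iff (n : ℕ) : gi ^ n = gi ↔ n % 4 = 1 := by
  rw [← gi_pow_mod_four]
  have : n % 4 < 4 := Nat.mod_lt _ (by norm_num)
  interval_cases n % 4 <;> decide

/-- Differences of distinct powers of `i` divide 2, so an odd prime `π` divides none of them.
Exactly one branch of the definition can therefore fire. -/
theorem quarticSymbolPrime_gi {π : GaussianInt} (hπ : Prime π)
    (h : ¬ (⟨1, 1⟩ : GaussianInt) ∣ π) :
    quarticSymbolPrime gi π = gi ^ ((Zsqrtd.norm π).natAbs.pred / 4) := by
  have hd : ∀ g : GaussianInt, g ∣ 2 → ¬ π ∣ g := by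
    intro g hg hπg
    have h2 : π ∣ (⟨1, 1⟩ : GaussianInt) * ⟨1, -1⟩ :=
      (hπg.trans hg).trans (by exact ⟨1, by decide⟩)
    have ha : Associated π ⟨1, 1⟩ := by
      rcases hπ.dvd_or_dvd h2 with h3 | h3
      · exact hπ.associated_of_dvd prime_one_add_i h3
      · exact hπ.associated_of_dvd prime_one_add_i (h3.trans ⟨gi, by decide⟩)
    exact h ha.symm.dvd
  unfold quarticSymbolPrime
  rw [← gi_pow_mod_four]
  have : (Zsqrtd.norm π).natAbs.pred / 4 % 4 < 4 := Nat.mod_lt _ (by norm_num)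
  generalize (Zsqrtd.norm π).natAbs.pred / 4 % 4 = n at this
  interval_cases n
  · simp
  · have h1 := hd (gi - 1) ⟨⟨-1, -1⟩, by decide⟩
    have h2 := hd (gi + 1) ⟨⟨1, -1⟩, by decide⟩
    simp [h1, h2]
  · have h1 := hd (gi ^ 2 - 1) ⟨-1, by decide⟩
    have h2 : gi ^ 2 + 1 = 0 := by decide
    simp only [h1, h2, dvd_zero, if_false, if_true]
    decide
  · have h1 := hd (gi ^ 3 - 1) ⟨⟨-1, 1⟩, by decide⟩
    have h2 := hd (gi ^ 3 + 1) ⟨⟨1, 1⟩, by decide⟩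
    have h3 := hd (gi ^ 3 - gi) ⟨gi, by decide⟩
    have h4 : gi ^ 3 + gi = 0 := by decide
    simp only [h1, h2, h3, h4, dvd_zero, if_false, if_true]
    decide

/-- On integers congruent to 1 mod 4, `n ↦ (n - 1)/4 mod 4` turns products into sums, because
`(4m+1)(4n+1) = 4(4mn + m + n) + 1`. The norm congruence is carried along to keep the induction
going. -/
theorem prod_gi_pow (s : Multiset GaussianInt) (hs : ∀ g ∈ s, ¬ (⟨1, 1⟩ : GaussianInt) ∣ g) :
    (s.map fun g => gi ^ (g.norm.natAbs.pred / 4)).prod = gi ^ (s.prod.norm.natAbs.pred / 4) ∧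
      s.prod.norm.natAbs % 4 = 1 := by
  induction s using Multiset.induction with
  | empty => decide
  | cons a s ih =>
    obtain ⟨h1, h2⟩ := ih fun g hg => hs g (Multiset.mem_cons_of_mem hg)
    have h3 := natAbs_norm_mod_four (hs a (Multiset.mem_cons_self a s))
    rw [Multiset.map_cons, Multiset.prod_cons, Multiset.prod_cons, h1, ← pow_add, Zsqrtd.norm_mul,
      Int.natAbs_mul]
    generalize a.norm.natAbs = m at *
    generalize s.prod.norm.natAbs = n at *
    obtain ⟨m, rfl⟩ : ∃ m', m = 4 * m' + 1 := ⟨m / 4, by omega⟩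
    obtain ⟨n, rfl⟩ : ∃ n', n = 4 * n' + 1 := ⟨n / 4, by omega⟩
    have e : (4 * m + 1) * (4 * n + 1) = 4 * (4 * (m * n) + m + n) + 1 := by ring
    refine ⟨?_, by omega⟩
    rw [← gi_pow_mod_four, ← gi_pow_mod_four (Nat.pred _ / 4)]
    have : ((4 * m + 1).pred / 4 + (4 * n + 1).pred / 4) % 4 =
        ((4 * m + 1) * (4 * n + 1)).pred / 4 % 4 := by
      rw [e]
      simp only [Nat.pred_eq_sub_one]
      omega
    rw [this]

theorem quarticSymbol_gi {D : GaussianInt} (hD : ¬ (⟨1, 1⟩ : GaussianInt) ∣ D) :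
    quarticSymbol gi D = gi ^ (D.norm.natAbs.pred / 4) := by
  have h0 : D ≠ 0 := fun h => hD (h ▸ dvd_zero _)
  have hodd : ∀ g ∈ UniqueFactorizationMonoid.factors D, ¬ (⟨1, 1⟩ : GaussianInt) ∣ g :=
    fun g hg h => hD (h.trans (UniqueFactorizationMonoid.dvd_of_mem_factors hg))
  have hmap : (UniqueFactorizationMonoid.factors D).map (quarticSymbolPrime gi) =
      (UniqueFactorizationMonoid.factors D).map fun g => gi ^ (g.norm.natAbs.pred / 4) :=
    Multiset.map_congr rfl fun g hg =>
      quarticSymbolPrime_gi (UniqueFactorizationMonoid.prime_of_factor g hg) (hodd g hg)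
  obtain ⟨u, hu⟩ := UniqueFactorizationMonoid.factors_prod h0
  have hn : D.norm.natAbs = (UniqueFactorizationMonoid.factors D).prod.norm.natAbs := by
    conv_lhs => rw [← hu]
    rw [Zsqrtd.norm_mul, Int.natAbs_mul, Zsqrtd.norm_eq_one_iff.2 u.isUnit, mul_one]
  rw [quarticSymbol, hmap, (prod_gi_pow _ hodd).1, hn]

/-- A primary Gaussian integer has even imaginary part, and its coordinates add up to `1` mod `4`. -/
theorem coords_of_primary {D : GaussianInt} (hD : (⟨2, 2⟩ : GaussianInt) ∣ D - 1) :
    D.im % 2 = 0 ∧ (D.re + D.im) % 4 = 1 := by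
  obtain ⟨c, hc⟩ := hD
  have h1 := congrArg Zsqrtd.re hc
  have h2 := congrArg Zsqrtd.im hc
  simp only [Zsqrtd.re_sub, Zsqrtd.im_sub, Zsqrtd.re_mul, Zsqrtd.im_mul, Zsqrtd.re_one,
    Zsqrtd.im_one] at h1 h2
  omega

theorem odd_of_primary {D : GaussianInt} (hD : (⟨2, 2⟩ : GaussianInt) ∣ D - 1) :
    ¬ (⟨1, 1⟩ : GaussianInt) ∣ D := by
  rw [one_add_i_dvd_iff]
  have := coords_of_primary hD
  omega

theorem quarticSymbol_gi_eq_gi_iff {D : GaussianInt} (hD : (⟨2, 2⟩ : GaussianInt) ∣ D - 1) :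
    quarticSymbol gi D = gi ↔ D.re % 8 = 7 ∧ D.im % 4 = 2 := by
  rw [quarticSymbol_gi (odd_of_primary hD), gi_pow_eq_gi_iff]
  obtain ⟨h1, h2⟩ := coords_of_primary hD
  have hn : D.norm = D.re * D.re + D.im * D.im := by rw [Zsqrtd.norm_def]; ring
  have hmod : D.norm % 16 = (D.re % 16 * (D.re % 16) + D.im % 16 * (D.im % 16)) % 16 := by
    rw [hn, Int.add_emod, Int.mul_emod, Int.mul_emod D.im]
    simp [Int.add_emod]
  -- The residues 6, 7, 8 appear only through rounding in the division by 4; for primary `D` only 5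
  -- occurs.
  have hr : D.norm.natAbs.pred / 4 % 4 = 1 ↔ D.norm % 16 = 5 ∨ D.norm % 16 = 6 ∨
      D.norm % 16 = 7 ∨ D.norm % 16 = 8 := by
    have := GaussianInt.norm_nonneg D
    rw [Nat.pred_eq_sub_one]
    omega
  rw [hr, hmod]
  have ha : 0 ≤ D.re % 16 ∧ D.re % 16 < 16 := by omega
  have hb : 0 ≤ D.im % 16 ∧ D.im % 16 < 16 := by omega
  have ea : D.re % 8 = D.re % 16 % 8 := by omega
  have eb : D.im % 4 = D.im % 16 % 4 := by omega
  have e1 : D.im % 16 % 2 = 0 := by omega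
  have e2 : (D.re % 16 + D.im % 16) % 4 = 1 := by omega
  rw [ea, eb]
  generalize D.re % 16 = a at *
  generalize D.im % 16 = b at *
  obtain ⟨ha1, ha2⟩ := ha
  obtain ⟨hb1, hb2⟩ := hb
  interval_cases b <;> first | omega | (interval_cases a <;> omega)

/-! ### Additive maps given by Gaussian integers -/

/-- `J` need not be additive: it is only ever applied to `x` and to `J x`, and `J (J x) = -x` closes
the computation. -/
theorem iterate_eq_gaussian_pow {G : Type*} [AddCommGroup G] (F : G →+ G) (J : G → G)
    (hJ : ∀ x, J (J x) = -x) (α : GaussianInt) (hF : ∀ x, F x = α.re • x + α.im • J x)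
    (n : ℕ) (x : G) : F^[n] x = (α ^ n).re • x + (α ^ n).im • J x := by
  induction n generalizing x with
  | zero => simp
  | succ n ih =>
    rw [Function.iterate_succ_apply', ih, map_add, map_zsmul, map_zsmul, hF x, hF (J x), hJ,
      pow_succ, Zsqrtd.re_mul, Zsqrtd.im_mul]
    module

/-- `β = α⁸ - 16` annihilates `G`, hence so does its norm. As no nonzero integer annihilates `G`, `β
= 0`, and taking norms in `α⁸ = 16` gives `N(α)⁸ = 2⁸`. -/
theorem norm_eq_two_of_iterate_eq {G : Type*} [AddCommGroup G] (F : G →+ G) (J : G → G)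
    (hJ : ∀ x, J (J x) = -x) (α : GaussianInt) (hF : ∀ x, F x = α.re • x + α.im • J x)
    (h8 : ∀ x, F^[8] x = (16 : ℤ) • x) (hG : ∀ n : ℕ, n ≠ 0 → ∃ x : G, n • x ≠ 0) :
    α.norm = 2 := by
  have key : ∀ x, ((α ^ 8).re - 16) • x + (α ^ 8).im • J x = 0 := fun x => by
    have h1 := iterate_eq_gaussian_pow F J hJ α hF 8 x
    rw [h8] at h1
    rw [sub_smul, h1]
    abel
  have hn : ∀ x : G, (((α ^ 8).re - 16) ^ 2 + (α ^ 8).im ^ 2) • x = (0 : G) := fun x => by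
    have h1 := key x
    have h2 := key (J x)
    rw [hJ] at h2
    -- This is multiplication by the conjugate of `β`.
    have h3 := congrArg₂ (fun y z : G => ((α ^ 8).re - 16) • y - (α ^ 8).im • z) h1 h2
    simp only [smul_zero, sub_zero] at h3
    refine Eq.trans ?_ h3
    module
  have h0 : ((α ^ 8).re - 16) ^ 2 + (α ^ 8).im ^ 2 = 0 := by
    by_contra hne
    obtain ⟨x, hx⟩ := hG _ (Int.natAbs_ne_zero.2 hne)
    apply hx
    rw [← natCast_zsmul, Int.natAbs_of_nonneg (by positivity)]
    exact hn x
  have hre : (α ^ 8).re = 16 := by nlinarith [sq_nonneg ((α ^ 8).re - 16), sq_nonneg (α ^ 8).im]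
  have him : (α ^ 8).im = 0 := by nlinarith [sq_nonneg ((α ^ 8).re - 16), sq_nonneg (α ^ 8).im]
  have hnorm : α.norm ^ 8 = 2 ^ 8 := by
    have : α.norm ^ 8 = (α ^ 8).norm := (map_pow (Zsqrtd.normMonoidHom (d := -1)) α 8).symm
    rw [this, Zsqrtd.norm_def, hre, him]
    norm_num
  exact (pow_left_inj₀ (GaussianInt.norm_nonneg α) (by norm_num) (by norm_num)).1 hnorm

/-! ### Supersingular curves over the field with two elements -/

section CharTwo

open WeierstrassCurve WeierstrassCurve.Affine

variable {R k : Type*} [CommRing R] [Field k] [CharP k 2] [Algebra R k]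

/-- The squaring map as an algebra endomorphism over a ring whose image is fixed by squaring. -/
def frobeniusAlgHom (hfix : ∀ r : R, algebraMap R k r ^ 2 = algebraMap R k r) : k →ₐ[R] k :=
  { frobenius k 2 with commutes' := hfix }

theorem frobeniusAlgHom_apply (hfix : ∀ r : R, algebraMap R k r ^ 2 = algebraMap R k r) (x : k) :
    frobeniusAlgHom hfix x = x ^ 2 := rfl

theorem exists_some_eq {F : Type*} [Field F] {W : Affine F} {x y x' y' : F}
    (h : W.Nonsingular x y) (hx : x = x') (hy : y = y') :
    ∃ h', Point.some x y h = Point.some x' y' h' := by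
  subst hx hy
  exact ⟨h, rfl⟩

variable {W : WeierstrassCurve R}

/-- The `y`-derivative of the equation is `2y + 1 = 1`, so every affine solution is nonsingular. -/
theorem nonsingular_iff_charTwo (h₁ : algebraMap R k W.a₁ = 0) (h₃ : algebraMap R k W.a₃ = 1)
    (x y : k) : (W.baseChange k).toAffine.Nonsingular x y ↔
      y ^ 2 + y = x ^ 3 + algebraMap R k W.a₂ * x ^ 2 + algebraMap R k W.a₄ * x +
        algebraMap R k W.a₆ := by
  have heq : (W.baseChange k).toAffine.Equation x y ↔
      y ^ 2 + y = x ^ 3 + algebraMap R k W.a₂ * x ^ 2 + algebraMap R k W.a₄ * x +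
        algebraMap R k W.a₆ := by
    rw [equation_iff]
    simp [WeierstrassCurve.baseChange, h₁, h₃]
  rw [nonsingular_iff, heq, and_iff_left_iff_imp]
  intro _
  right
  simp [WeierstrassCurve.baseChange, h₁, h₃]
  intro h
  have h2 : (2 : k) = 0 := CharTwo.two_eq_zero
  have : (1 : k) = 0 := by linear_combination h - y * h2
  exact one_ne_zero this

theorem ne_negY_charTwo (h₁ : algebraMap R k W.a₁ = 0) (h₃ : algebraMap R k W.a₃ = 1) (x y : k) :
    y ≠ (W.baseChange k).toAffine.negY x y := by
  simp only [negY, WeierstrassCurve.baseChange, map_a₁, map_a₃, h₁, h₃]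
  intro h
  have h2 : (2 : k) = 0 := CharTwo.two_eq_zero
  have : (1 : k) = 0 := by linear_combination h - y * h2
  exact one_ne_zero this

theorem exists_point_charTwo [IsAlgClosed k] (h₁ : algebraMap R k W.a₁ = 0)
    (h₃ : algebraMap R k W.a₃ = 1) (x : k) :
    ∃ y, (W.baseChange k).toAffine.Nonsingular x y := by
  simp only [nonsingular_iff_charTwo h₁ h₃]
  generalize x ^ 3 + algebraMap R k W.a₂ * x ^ 2 + algebraMap R k W.a₄ * x +
    algebraMap R k W.a₆ = c
  have hdeg : (Polynomial.X ^ 2 + Polynomial.X - Polynomial.C c : Polynomial k).degree ≠ 0 := by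
    have : (Polynomial.X ^ 2 + Polynomial.X - Polynomial.C c : Polynomial k).degree = 2 := by
      compute_degree!
    rw [this]
    decide
  obtain ⟨y, hy⟩ := IsAlgClosed.exists_root _ hdeg
  refine ⟨y, ?_⟩
  simpa [Polynomial.IsRoot, sub_eq_zero] using hy

variable [DecidableEq k]

/-- The tangent slope has denominator `2y + a₃ = 1`, hence equals `x² + a₄`; its square gives the
new abscissa. -/
theorem exists_two_smul_charTwo (h₁ : algebraMap R k W.a₁ = 0) (h₃ : algebraMap R k W.a₃ = 1)
    {x y : k} (h : (W.baseChange k).toAffine.Nonsingular x y) :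
    ∃ (y' : k) (h' : (W.baseChange k).toAffine.Nonsingular
        (x ^ 4 + (algebraMap R k W.a₄ ^ 2 + algebraMap R k W.a₂)) y'),
      (2 : ℤ) • Point.some x y h = Point.some _ y' h' := by
  have hy := ne_negY_charTwo h₁ h₃ x y
  have h2 : (2 : k) = 0 := CharTwo.two_eq_zero
  have hX : (W.baseChange k).toAffine.addX x x ((W.baseChange k).toAffine.slope x x y y) =
      x ^ 4 + (algebraMap R k W.a₄ ^ 2 + algebraMap R k W.a₂) := by
    rw [slope_of_Y_ne rfl hy]
    simp only [addX, negY, WeierstrassCurve.baseChange, map_a₁, map_a₂, map_a₃, map_a₄, h₁, h₃]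
    have e : y - (-y - 0 * x - 1) = 1 := by linear_combination y * h2
    rw [e, div_one]
    linear_combination (4 * x ^ 4 + 6 * x ^ 3 * algebraMap R k W.a₂ +
      2 * x ^ 2 * algebraMap R k W.a₂ ^ 2 + 3 * x ^ 2 * algebraMap R k W.a₄ +
      2 * x * algebraMap R k W.a₂ * algebraMap R k W.a₄ - algebraMap R k W.a₂ - x) * h2
  rw [two_smul, Point.add_self_of_Y_ne hy]
  rw [← hX]
  exact ⟨_, _, rfl⟩

theorem iterate_map_frobenius_some (hfix : ∀ r : R, algebraMap R k r ^ 2 = algebraMap R k r)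
    (n : ℕ) {x y : k} (h : (W.baseChange k).toAffine.Nonsingular x y) :
    ∃ h', (Point.map (W' := W) (frobeniusAlgHom hfix))^[n] (Point.some x y h) =
      Point.some (x ^ 2 ^ n) (y ^ 2 ^ n) h' := by
  induction n with
  | zero => exact exists_some_eq h (by simp) (by simp)
  | succ n ih =>
    obtain ⟨h', e⟩ := ih
    rw [Function.iterate_succ_apply', e, Point.map_some]
    exact exists_some_eq _ (by rw [frobeniusAlgHom_apply, ← pow_mul, ← pow_succ])
      (by rw [frobeniusAlgHom_apply, ← pow_mul, ← pow_succ])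

/-- Doubling acts on abscissas by `x ↦ x⁴ + c`, where `c = a₄ + a₂` is fixed by squaring. Doubling
twice gives `x¹⁶ + 2c = x¹⁶`, so `F⁴ P = ±4 P`. -/
theorem iterate_map_frobenius_eight (hfix : ∀ r : R, algebraMap R k r ^ 2 = algebraMap R k r)
    (h₁ : algebraMap R k W.a₁ = 0) (h₃ : algebraMap R k W.a₃ = 1)
    (P : (W.baseChange k).toAffine.Point) :
    (Point.map (W' := W) (frobeniusAlgHom hfix))^[8] P = (16 : ℤ) • P := by
  set F := Point.map (W' := W) (frobeniusAlgHom hfix) with hF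
  rcases P with _ | ⟨x, y, h⟩
  · rw [← Point.zero_def, iterate_map_zero, smul_zero]
  have h4 : F^[4] (Point.some x y h) = (4 : ℤ) • Point.some x y h ∨
      F^[4] (Point.some x y h) = -((4 : ℤ) • Point.some x y h) := by
    obtain ⟨h', e⟩ := iterate_map_frobenius_some hfix 4 h
    obtain ⟨y₂, h₂, e₂⟩ := exists_two_smul_charTwo h₁ h₃ h
    obtain ⟨y₄, h₄, e₄⟩ := exists_two_smul_charTwo h₁ h₃ h₂
    rw [← e₂, ← mul_smul, show (2 * 2 : ℤ) = 4 by norm_num] at e₄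
    rw [e, e₄]
    refine Point.X_eq_iff.1 ?_
    have h2 : (2 : k) = 0 := CharTwo.two_eq_zero
    rw [hfix]
    have hc : (algebraMap R k W.a₄ + algebraMap R k W.a₂) ^ 2 =
        algebraMap R k W.a₄ + algebraMap R k W.a₂ := by rw [← map_add, hfix]
    generalize algebraMap R k W.a₄ + algebraMap R k W.a₂ = c at *
    have hq : (x ^ 4 + c) ^ 4 = x ^ 16 + c := by
      have : (x ^ 4 + c) ^ 4 = ((x ^ 4 + c) ^ 2) ^ 2 := by ring
      rw [this, CharTwo.add_sq, CharTwo.add_sq, hc, hc]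
      ring
    rw [hq]
    linear_combination -c * h2
  have h8 : F^[8] (Point.some x y h) = F^[4] (F^[4] (Point.some x y h)) :=
    Function.iterate_add_apply F 4 4 _
  rw [h8]
  -- The sign may depend on the point, but additivity of `F` applies the same sign twice.
  rcases h4 with h4 | h4
  · rw [h4, iterate_map_zsmul, h4]
    module
  · rw [h4, iterate_map_neg, iterate_map_zsmul, h4]
    module

/-- If `n` killed all points, `F^(8m) = 16^m` would depend only on `16^m mod n`, so two different
powers of Frobenius would agree. Every element of `k` is an abscissa, so two different monomials
would agree on an infinite field. -/
theorem exists_nsmul_ne_zero_charTwo [IsAlgClosed k]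
    (hfix : ∀ r : R, algebraMap R k r ^ 2 = algebraMap R k r)
    (h₁ : algebraMap R k W.a₁ = 0) (h₃ : algebraMap R k W.a₃ = 1) (n : ℕ) (hn : n ≠ 0) :
    ∃ P : (W.baseChange k).toAffine.Point, n • P ≠ 0 := by
  by_contra! hkill
  have : NeZero n := ⟨hn⟩
  have hiter : ∀ (m : ℕ) (P : (W.baseChange k).toAffine.Point),
      (Point.map (W' := W) (frobeniusAlgHom hfix))^[8 * m] P = (16 ^ m : ℤ) • P := by
    intro m
    induction m with
    | zero => simp
    | succ m ih =>
      intro P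
      rw [mul_add, mul_one, Function.iterate_add_apply, iterate_map_frobenius_eight hfix h₁ h₃, ih,
        pow_succ, mul_smul]
  obtain ⟨i, j, hij, heq⟩ :=
    Finite.exists_ne_map_eq_of_infinite fun i : ℕ => ((16 : ℤ) ^ i : ZMod n)
  have hdvd : (n : ℤ) ∣ 16 ^ i - 16 ^ j := by
    rw [← ZMod.intCast_zmod_eq_zero_iff_dvd]
    push_cast
    push_cast at heq
    rw [heq, sub_self]
  have hpow : ∀ x : k, x ^ 2 ^ (8 * i) = x ^ 2 ^ (8 * j) := by
    intro x
    obtain ⟨y, h⟩ := exists_point_charTwo (W := W) h₁ h₃ x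
    obtain ⟨hi, ei⟩ := iterate_map_frobenius_some hfix (8 * i) h
    obtain ⟨hj, ej⟩ := iterate_map_frobenius_some hfix (8 * j) h
    have e : Point.some _ _ hi = Point.some _ _ hj := by
      rw [← ei, ← ej, hiter, hiter, ← sub_eq_zero, ← sub_smul]
      obtain ⟨c, hc⟩ := hdvd
      rw [hc, mul_comm, mul_smul, natCast_zsmul, hkill, smul_zero]
    exact (Point.some.inj e).1
  have hpoly : (Polynomial.X ^ 2 ^ (8 * i) : Polynomial k) = Polynomial.X ^ 2 ^ (8 * j) :=
    Polynomial.funext fun x => by simpa using hpow x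
  have hdeg := congrArg Polynomial.natDegree hpoly
  rw [Polynomial.natDegree_X_pow, Polynomial.natDegree_X_pow] at hdeg
  have := Nat.pow_right_injective le_rfl hdeg
  omega

/-- If the Frobenius of a supersingular curve over the field with two elements is `a + b J`, where
`J (x, y) = (x + 1, y + x + t)`, then `a + b i` has norm `2`. -/
theorem norm_eq_two_of_frobenius_eq [IsAlgClosed k]
    (hfix : ∀ r : R, algebraMap R k r ^ 2 = algebraMap R k r)
    (h₁ : algebraMap R k W.a₁ = 0) (h₃ : algebraMap R k W.a₃ = 1) (t : k) (α : GaussianInt)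
    (hα : ∀ (x y : k) (h : (W.baseChange k).toAffine.Nonsingular x y),
      ∃ (h' : (W.baseChange k).toAffine.Nonsingular (x ^ 2) (y ^ 2))
        (h'' : (W.baseChange k).toAffine.Nonsingular (x + 1) (y + x + t)),
        Point.some _ _ h' = α.re • Point.some _ _ h + α.im • Point.some _ _ h'') :
    α.norm = 2 := by
  -- That `J` preserves the curve is already part of `hα`.
  have hns : ∀ {x y : k}, (W.baseChange k).toAffine.Nonsingular x y →
      (W.baseChange k).toAffine.Nonsingular (x + 1) (y + x + t) := fun {x y} h => (hα x y h).2.1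
  let J : (W.baseChange k).toAffine.Point → (W.baseChange k).toAffine.Point := fun P =>
    match P with
    | .zero => .zero
    | .some _ _ h => .some _ _ (hns h)
  refine norm_eq_two_of_iterate_eq (Point.map (W' := W) (frobeniusAlgHom hfix)) J ?_ α ?_
    (iterate_map_frobenius_eight hfix h₁ h₃) (exists_nsmul_ne_zero_charTwo hfix h₁ h₃)
  · rintro (_ | ⟨x, y, h⟩)
    · rfl
    · simp only [J, Point.neg_some]
      have h2 : (2 : k) = 0 := CharTwo.two_eq_zero
      congr 1
      · linear_combination h2
      · simp only [negY, WeierstrassCurve.baseChange, map_a₁, map_a₃, h₁, h₃]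
        linear_combination (y + x + 1 + t) * h2
  · rintro (_ | ⟨x, y, h⟩)
    · change (0 : (W.baseChange k).toAffine.Point) = α.re • 0 + α.im • 0
      simp
    · obtain ⟨h', h'', e⟩ := hα x y h
      exact e

/-- On `y² + y = x³ + x² + δ` over the field with two elements, the Frobenius is `±(1 ± J)`, where
`J (x, y) = (x + 1, y + x + t)`. -/
theorem exists_frobenius_eq (hfix : ∀ r : R, algebraMap R k r ^ 2 = algebraMap R k r)
    (h₁ : algebraMap R k W.a₁ = 0) (h₂ : algebraMap R k W.a₂ = 1)
    (h₃ : algebraMap R k W.a₃ = 1) (h₄ : algebraMap R k W.a₄ = 0) (t : k) (ht : t = 0 ∨ t = 1) :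
    ∃ α : GaussianInt, ∀ (x y : k) (h : (W.baseChange k).toAffine.Nonsingular x y),
      ∃ (h' : (W.baseChange k).toAffine.Nonsingular (x ^ 2) (y ^ 2))
        (h'' : (W.baseChange k).toAffine.Nonsingular (x + 1) (y + x + t)),
        Point.some _ _ h' = α.re • Point.some _ _ h + α.im • Point.some _ _ h'' := by
  have h2 : (2 : k) = 0 := CharTwo.two_eq_zero
  have hδ : algebraMap R k W.a₆ = 0 ∨ algebraMap R k W.a₆ = 1 := by
    have := hfix W.a₆
    have h0 : algebraMap R k W.a₆ * (algebraMap R k W.a₆ - 1) = 0 := by linear_combination this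
    simpa [sub_eq_zero] using h0
  have hns : ∀ {x y : k}, (W.baseChange k).toAffine.Nonsingular x y → ∀ t' : k, t' ^ 2 = t' →
      (W.baseChange k).toAffine.Nonsingular (x + 1) (y + x + t') := by
    intro x y h t' ht'
    rw [nonsingular_iff_charTwo h₁ h₃, h₂, h₄] at h ⊢
    linear_combination h + ht' + (y * x + y * t' + x * t' - x ^ 2 - 2 * x - 1 + t') * h2
  have hfr : ∀ {x y : k}, (W.baseChange k).toAffine.Nonsingular x y →
      (W.baseChange k).toAffine.Nonsingular (x ^ 2) (y ^ 2) := fun {x y} h =>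
    (Affine.baseChange_nonsingular (W := W) (frobeniusAlgHom hfix).injective x y).mpr h
  -- With `J₀` the case `t = 0`, the chord through `P` and `J₀ P` has slope `x`. The sum is the
  -- Frobenius of `P` when `a₆` reduces to 1 and its negative when `a₆` reduces to 0.
  have hsum : ∀ {x y : k} (h : (W.baseChange k).toAffine.Nonsingular x y)
      (h' : (W.baseChange k).toAffine.Nonsingular (x + 1) (y + x + 0)),
      ∃ h'', Point.some x y h + Point.some _ _ h' =
        Point.some (x ^ 2) (y ^ 2 + algebraMap R k W.a₆ + 1) h'' := by
    intro x y h h'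
    have hne : x ≠ x + 1 := by simp
    have hs : (W.baseChange k).toAffine.slope x (x + 1) y (y + x + 0) = x := by
      rw [slope_of_X_ne hne]
      have : x - (x + 1) = -1 := by ring
      rw [this]
      ring
    have hX : (W.baseChange k).toAffine.addX x (x + 1) x = x ^ 2 := by
      simp only [addX, WeierstrassCurve.baseChange, map_a₁, map_a₂, h₁, h₂]
      linear_combination (-x - 1) * h2
    have hY : (W.baseChange k).toAffine.addY x (x + 1) y x =
        y ^ 2 + algebraMap R k W.a₆ + 1 := by
      rw [addY, negAddY, hX]
      simp only [negY, WeierstrassCurve.baseChange, map_a₁, map_a₃, h₁, h₃]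
      rw [nonsingular_iff_charTwo h₁ h₃, h₂, h₄] at h
      linear_combination -h + (- x ^ 3 - algebraMap R k W.a₆ - 1) * h2
    rw [Point.add_of_X_ne hne]
    exact exists_some_eq _ (by rw [hs, hX]) (by rw [hs, hY])
  have hsum' : ∃ ε : ℤ, ∀ {x y : k} (h : (W.baseChange k).toAffine.Nonsingular x y)
      (h' : (W.baseChange k).toAffine.Nonsingular (x + 1) (y + x + 0)),
      Point.some _ _ (hfr h) = ε • (Point.some x y h + Point.some _ _ h') := by
    rcases hδ with hδ | hδ
    · refine ⟨-1, fun {x y} h h' => ?_⟩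
      obtain ⟨h'', e⟩ := hsum h h'
      rw [e, neg_one_smul, Point.neg_some]
      congr 1
      simp only [negY, WeierstrassCurve.baseChange, map_a₁, map_a₃, h₁, h₃, hδ]
      linear_combination (y ^ 2 + 1) * h2
    · refine ⟨1, fun {x y} h h' => ?_⟩
      obtain ⟨h'', e⟩ := hsum h h'
      rw [e, one_smul]
      congr 1
      rw [hδ]
      linear_combination -h2
  obtain ⟨ε, hε⟩ := hsum'
  rcases ht with rfl | rfl
  · refine ⟨⟨ε, ε⟩, fun x y h => ⟨hfr h, hns h 0 (by simp), ?_⟩⟩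
    rw [hε h (hns h 0 (by simp)), smul_add]
  -- The map with `t = 1` is the negative of the one with `t = 0`.
  · refine ⟨⟨ε, -ε⟩, fun x y h => ⟨hfr h, hns h 1 (by simp), ?_⟩⟩
    rw [hε h (hns h 0 (by simp)), smul_add, neg_smul, ← smul_neg, Point.neg_some]
    congr 3
    simp only [negY, WeierstrassCurve.baseChange, map_a₁, map_a₃, h₁, h₃]
    linear_combination (y + x + 1) * h2

end CharTwo

/-! ### The local rings of `ℤ[i]` -/

theorem exists_localRing_of_valuation_le {𝔭 : Place} {x : K} (hx : 𝔭.valuation K x ≤ 1) :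
    ∃ y : LocalRingAt 𝔭, algebraMap (LocalRingAt 𝔭) K y = x := by
  refine ⟨⟨x, ?_⟩, rfl⟩
  rw [HeightOneSpectrum.valuationSubringAtPrime_eq_valuationSubring]
  exact hx

theorem valuation_localRing_le {𝔭 : Place} (x : LocalRingAt 𝔭) :
    𝔭.valuation K (algebraMap (LocalRingAt 𝔭) K x) ≤ 1 :=
  HeightOneSpectrum.valuationSubringAtPrime_le_valuation 𝔭 x.2

theorem isUnit_localRing_iff {𝔭 : Place} (x : LocalRingAt 𝔭) :
    IsUnit x ↔ 𝔭.valuation K (algebraMap (LocalRingAt 𝔭) K x) = 1 := by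
  constructor
  · rintro ⟨u, rfl⟩
    refine le_antisymm (valuation_localRing_le _) ?_
    have h : 𝔭.valuation K (algebraMap (LocalRingAt 𝔭) K (u : LocalRingAt 𝔭)) *
        𝔭.valuation K (algebraMap (LocalRingAt 𝔭) K (↑u⁻¹ : LocalRingAt 𝔭)) = 1 := by
      rw [← map_mul, ← map_mul, Units.mul_inv, map_one, map_one]
    rw [← h]
    exact mul_le_of_le_one_right' (valuation_localRing_le _)
  · intro h
    have h0 : algebraMap (LocalRingAt 𝔭) K x ≠ 0 := fun h0 => by simp [h0] at h
    obtain ⟨y, hy⟩ := exists_localRing_of_valuation_le (𝔭 := 𝔭)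
      (x := (algebraMap (LocalRingAt 𝔭) K x)⁻¹) (by rw [map_inv₀, h, inv_one])
    refine IsUnit.of_mul_eq_one y (FaithfulSMul.algebraMap_injective (LocalRingAt 𝔭) K ?_)
    rw [map_mul, hy, map_one, mul_inv_cancel₀ h0]

/-- Good reduction means that some integral model has unit discriminant. -/
theorem hasGoodReductionAt_iff (𝔭 : Place) (E : WeierstrassCurve K) :
    HasGoodReductionAt 𝔭 E ↔ ∃ (C : WeierstrassCurve.VariableChange K)
      (W : WeierstrassCurve (LocalRingAt 𝔭)), W.baseChange K = C • E ∧ IsUnit W.Δ := by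
  have hunit : ∀ x : LocalRingAt 𝔭, IsUnit x ↔
      (IsDiscreteValuationRing.maximalIdeal (LocalRingAt 𝔭)).valuation K
        (algebraMap (LocalRingAt 𝔭) K x) = 1 := by
    intro x
    rw [HeightOneSpectrum.valuation_eq_one_iff_notMem]
    exact IsLocalRing.notMem_maximalIdeal.symm
  constructor
  · intro h
    refine ⟨_, WeierstrassCurve.integralModel (LocalRingAt 𝔭) (E.minimal (LocalRingAt 𝔭)),
      WeierstrassCurve.baseChange_integralModel_eq _ _, ?_⟩
    rw [hunit, WeierstrassCurve.integralModel_Δ_eq]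
    exact h.goodReduction
  · rintro ⟨C, W, hW, hΔ⟩
    have hmin : (E.minimal (LocalRingAt 𝔭)).IsMinimal (LocalRingAt 𝔭) := inferInstance
    refine ⟨?_⟩
    set C₀ := (E.exists_isMinimal (LocalRingAt 𝔭)).choose
    have hE : (C * C₀⁻¹) • E.minimal (LocalRingAt 𝔭) = W.baseChange K := by
      rw [hW, WeierstrassCurve.minimal, smul_smul, inv_mul_cancel_right]
    have hint : WeierstrassCurve.IsIntegral (LocalRingAt 𝔭)
        ((C * C₀⁻¹) • E.minimal (LocalRingAt 𝔭)) := ⟨W, hE⟩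
    have hval : (WeierstrassCurve.valuation_Δ_aux (LocalRingAt 𝔭)
        ((C * C₀⁻¹) • E.minimal (LocalRingAt 𝔭)) : WithZero (Multiplicative ℤ)) = 1 := by
      rw [WeierstrassCurve.valuation_Δ_aux_eq_of_isIntegral, hE, WeierstrassCurve.baseChange,
        WeierstrassCurve.map_Δ]
      exact (hunit _).1 hΔ
    -- Maximality bounds the discriminant value of `W` only once the minimal one is known not to
    -- exceed it; that is automatic, since `W` attains the largest possible value 1.
    have hle := hmin.val_Δ_maximal.2 hint
      (by
        rw [← Subtype.coe_le_coe]
        exact le_trans (WeierstrassCurve.valuation_Δ_aux (LocalRingAt 𝔭)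
          ((1 : WeierstrassCurve.VariableChange K) • E.minimal (LocalRingAt 𝔭))).2 hval.ge)
    rw [← Subtype.coe_le_coe] at hle
    simp only [one_smul] at hle
    rw [hval, WeierstrassCurve.valuation_Δ_aux_eq_of_isIntegral] at hle
    refine le_antisymm ?_ hle
    rw [← WeierstrassCurve.integralModel_Δ_eq (LocalRingAt 𝔭)]
    exact HeightOneSpectrum.valuation_le_one _ _

theorem curve_Δ (D : GaussianInt) : (curve D).Δ = -64 * algebraMap GaussianInt K D ^ 3 := by
  simp only [curve, WeierstrassCurve.Δ, WeierstrassCurve.b₂, WeierstrassCurve.b₄,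
    WeierstrassCurve.b₆, WeierstrassCurve.b₈]
  ring

/-- The discriminant relation between the curve and a model of it. -/
theorem Δ_model {𝔭 : Place} {D : GaussianInt} {C : WeierstrassCurve.VariableChange K}
    {W : WeierstrassCurve (LocalRingAt 𝔭)} (hW : W.baseChange K = C • curve D) :
    (C.u : K) ^ 12 * algebraMap (LocalRingAt 𝔭) K W.Δ = -64 * algebraMap GaussianInt K D ^ 3 := by
  have h : (W.baseChange K).Δ = algebraMap (LocalRingAt 𝔭) K W.Δ := W.map_Δ _
  rw [← h, hW, WeierstrassCurve.variableChange_Δ, curve_Δ, ← mul_assoc, ← mul_pow,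
    Units.mul_inv, one_pow, one_mul]

theorem not_two_mem_of_mem {D : GaussianInt} (hD : (⟨2, 2⟩ : GaussianInt) ∣ D - 1) {𝔭 : Place}
    (h : D ∈ 𝔭.asIdeal) : (2 : GaussianInt) ∉ 𝔭.asIdeal := by
  intro h2
  obtain ⟨c, hc⟩ := hD
  apply 𝔭.isPrime.ne_top
  rw [Ideal.eq_top_iff_one]
  have h1 : (1 : GaussianInt) = D - 2 * (⟨1, 1⟩ * c) := by
    have : (⟨2, 2⟩ : GaussianInt) = 2 * ⟨1, 1⟩ := by decide
    rw [this] at hc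
    linear_combination -hc
  rw [h1]
  exact sub_mem h (Ideal.mul_mem_right _ _ h2)

/-- As 2 is a unit at `𝔭`, the discriminant relation reads `v(u)¹² = v(D)³`, hence `v(u)⁴ = v(D) <
1`. Discreteness then puts `D` in `𝔭⁴`. -/
theorem not_hasGoodReductionAt_of_mem {D : GaussianInt} (hD : (⟨2, 2⟩ : GaussianInt) ∣ D - 1)
    (hfree : ∀ π : GaussianInt, Prime π → ¬ π ^ 4 ∣ D) {𝔭 : Place} (h𝔭 : D ∈ 𝔭.asIdeal) :
    ¬ HasGoodReductionAt 𝔭 (curve D) := by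
  rw [hasGoodReductionAt_iff]
  rintro ⟨C, W, hW, hΔ⟩
  have h := congrArg (𝔭.valuation K) (Δ_model hW)
  rw [isUnit_localRing_iff] at hΔ
  have h2 : 𝔭.valuation K (-64 : K) = 1 := by
    have h2' : 𝔭.valuation K (algebraMap GaussianInt K 2) = 1 :=
      HeightOneSpectrum.valuation_eq_one_iff_notMem _ |>.2 (not_two_mem_of_mem hD h𝔭)
    have : (-64 : K) = -(algebraMap GaussianInt K 2) ^ 6 := by
      rw [map_ofNat]; norm_num
    rw [this, Valuation.map_neg, map_pow, h2', one_pow]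
  rw [map_mul, map_mul, hΔ, h2, mul_one, one_mul, map_pow, map_pow] at h
  have h4 : 𝔭.valuation K (C.u : K) ^ 4 = 𝔭.valuation K (algebraMap GaussianInt K D) := by
    refine (pow_left_inj₀ zero_le zero_le (n := 3) (by norm_num)).1 ?_
    rw [← h, ← pow_mul]
  have hlt : 𝔭.valuation K (algebraMap GaussianInt K D) < 1 :=
    (HeightOneSpectrum.valuation_lt_one_iff_mem _ _).2 h𝔭
  rw [← h4, pow_lt_one_iff_of_nonneg zero_le (by norm_num)] at hlt
  have hu : 𝔭.valuation K (C.u : K) ≤ WithZero.exp (-1 : ℤ) := by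
    have hu0 : 𝔭.valuation K (C.u : K) ≠ 0 := (Valuation.ne_zero_iff _).2 C.u.ne_zero
    rw [← WithZero.exp_zero, ← WithZero.log_lt_iff_lt_exp hu0] at hlt
    rw [← WithZero.log_le_iff_le_exp hu0]
    omega
  have hD4 : 𝔭.intValuation D ≤ WithZero.exp (-((4 : ℕ) : ℤ)) := by
    rw [← HeightOneSpectrum.valuation_of_algebraMap (K := K), ← h4]
    refine (pow_le_pow_left₀ zero_le hu 4).trans ?_
    rw [← WithZero.exp_nsmul]
    simp
  obtain ⟨ϖ, hϖ⟩ := IsPrincipalIdealRing.principal 𝔭.asIdeal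
  have hϖ' : 𝔭.asIdeal = Ideal.span {ϖ} := hϖ
  have hp : Prime ϖ := by
    have h0 : ϖ ≠ 0 := by
      rintro rfl
      exact 𝔭.ne_bot (by rw [hϖ']; simp)
    rw [← Ideal.span_singleton_prime h0, ← hϖ']
    exact 𝔭.isPrime
  refine hfree ϖ hp ?_
  rw [HeightOneSpectrum.intValuation_le_pow_iff_mem, hϖ', Ideal.span_singleton_pow,
    Ideal.mem_span_singleton] at hD4
  exact hD4
/-! ### The local ring at `1 + i` -/

theorem not_mem_placeTwo_iff (g : GaussianInt) :
    g ∉ placeTwo.asIdeal ↔ ¬ (⟨1, 1⟩ : GaussianInt) ∣ g :=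
  not_congr Ideal.mem_span_singleton

theorem algebraMap_mem_maximalIdeal_iff (g : GaussianInt) :
    algebraMap GaussianInt (LocalRingAt placeTwo) g ∈
      IsLocalRing.maximalIdeal (LocalRingAt placeTwo) ↔ (⟨1, 1⟩ : GaussianInt) ∣ g := by
  rw [IsLocalization.AtPrime.to_map_mem_maximal_iff (LocalRingAt placeTwo) placeTwo.asIdeal]
  exact Ideal.mem_span_singleton

theorem isCoprime_eight {d : GaussianInt} (hd : ¬ (⟨1, 1⟩ : GaussianInt) ∣ d) :
    IsCoprime d 8 := by
  have h : (8 : GaussianInt) = gi * ⟨1, 1⟩ ^ 6 := by decide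
  have hu : IsUnit gi := IsUnit.of_mul_eq_one (-gi) (by decide)
  rw [h, isCoprime_mul_unit_left_right hu]
  exact ((prime_one_add_i.coprime_iff_not_dvd.2 hd).symm).pow_right

/-- Denominators are prime to `1 + i`, hence invertible modulo 8. The modulus 8 suffices because the
strongest congruence needed, from `u⁶ a₆`, is modulo 8. -/
theorem exists_gaussianInt_congr (x : LocalRingAt placeTwo) :
    ∃ (g : GaussianInt) (z : LocalRingAt placeTwo),
      x = algebraMap GaussianInt (LocalRingAt placeTwo) g + 8 * z := by
  obtain ⟨⟨n, d⟩, hnd⟩ := IsLocalization.surj placeTwo.asIdeal.primeCompl x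
  obtain ⟨u, v, huv⟩ := isCoprime_eight ((not_mem_placeTwo_iff _).1 d.2)
  refine ⟨n * u, x * algebraMap GaussianInt (LocalRingAt placeTwo) v, ?_⟩
  have h := congrArg (algebraMap GaussianInt (LocalRingAt placeTwo)) huv
  simp only [map_add, map_mul, map_one, map_ofNat] at h hnd ⊢
  linear_combination algebraMap GaussianInt (LocalRingAt placeTwo) u * hnd - x * h

theorem algebraMap_localRing_injective (𝔭 : Place) :
    Function.Injective (algebraMap GaussianInt (LocalRingAt 𝔭)) := fun _ _ h =>
  FaithfulSMul.algebraMap_injective GaussianInt K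
    (congrArg (algebraMap (LocalRingAt 𝔭) K) h)

theorem dvd_of_algebraMap_dvd {m g : GaussianInt} (hm : m ∣ 8)
    (h : algebraMap GaussianInt (LocalRingAt placeTwo) m ∣
      algebraMap GaussianInt (LocalRingAt placeTwo) g) : m ∣ g := by
  obtain ⟨x, hx⟩ := h
  obtain ⟨⟨n, d⟩, hnd⟩ := IsLocalization.surj placeTwo.asIdeal.primeCompl x
  have hc : IsCoprime m d :=
    ((isCoprime_eight ((not_mem_placeTwo_iff _).1 d.2)).of_isCoprime_of_dvd_right hm).symm
  refine hc.dvd_of_dvd_mul_right ⟨n, algebraMap_localRing_injective placeTwo ?_⟩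
  rw [map_mul, map_mul, hx, ← hnd]
  ring

theorem residue_eq_zero_or_one (x : LocalRingAt placeTwo) :
    IsLocalRing.residue (LocalRingAt placeTwo) x = 0 ∨
      IsLocalRing.residue (LocalRingAt placeTwo) x = 1 := by
  obtain ⟨g, z, rfl⟩ := exists_gaussianInt_congr x
  have h8 : (8 : LocalRingAt placeTwo) * z ∈
      IsLocalRing.maximalIdeal (LocalRingAt placeTwo) := by
    refine Ideal.mul_mem_right _ _ ?_
    have := (algebraMap_mem_maximalIdeal_iff 8).2 ((one_add_i_dvd_iff _).2 (by decide))
    rwa [map_ofNat] at this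
  rw [map_add, (IsLocalRing.residue_eq_zero_iff _).2 h8, add_zero]
  by_cases hg : (⟨1, 1⟩ : GaussianInt) ∣ g
  · left
    exact (IsLocalRing.residue_eq_zero_iff _).2 ((algebraMap_mem_maximalIdeal_iff g).2 hg)
  · right
    have h1 : (⟨1, 1⟩ : GaussianInt) ∣ g - 1 := by
      rw [one_add_i_dvd_iff] at hg ⊢
      simp only [Zsqrtd.re_sub, Zsqrtd.im_sub, Zsqrtd.re_one, Zsqrtd.im_one]
      omega
    have h2 := (IsLocalRing.residue_eq_zero_iff _).2 ((algebraMap_mem_maximalIdeal_iff _).2 h1)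
    rwa [map_sub, map_sub, map_one, map_one, sub_eq_zero] at h2

theorem placeNorm_placeTwo : placeNorm placeTwo = 2 := by
  rw [placeNorm, Nat.card_eq_two_iff]
  refine ⟨0, 1, ?_, ?_⟩
  · intro h
    have h1 : (1 : GaussianInt) ∈ placeTwo.asIdeal := by
      rw [← Ideal.Quotient.eq_zero_iff_mem, map_one, h]
    exact placeTwo.isPrime.ne_top ((Ideal.eq_top_iff_one _).2 h1)
  · rw [Set.eq_univ_iff_forall]
    intro x
    obtain ⟨g, rfl⟩ := Ideal.Quotient.mk_surjective x
    by_cases hg : (⟨1, 1⟩ : GaussianInt) ∣ g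
    · left
      exact Ideal.Quotient.eq_zero_iff_mem.2 (Ideal.mem_span_singleton.2 hg)
    · right
      rw [Set.mem_singleton_iff, ← map_one (Ideal.Quotient.mk placeTwo.asIdeal), Ideal.Quotient.eq]
      refine Ideal.mem_span_singleton.2 ?_
      rw [one_add_i_dvd_iff] at hg ⊢
      simp only [Zsqrtd.re_sub, Zsqrtd.im_sub, Zsqrtd.re_one, Zsqrtd.im_one]
      omega

/-! ### Good reduction at `1 + i` -/

/-- Since `D` is odd, the congruence mod 4 makes `r` odd, and the one mod 2 then makes `s` odd. With
`sτ` odd, the imaginary part mod 4 gives `im D ≡ 2`, and the real part makes `re r` odd and `im r`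
even. The real part of the last congruence then reduces to `re D + 1 ≡ 0 mod 8`. -/
theorem coords_of_congruences {D r s τ : GaussianInt} (hD : (⟨2, 2⟩ : GaussianInt) ∣ D - 1)
    (hτ : ¬ (⟨1, 1⟩ : GaussianInt) ∣ τ) (h2 : (2 : GaussianInt) ∣ 3 * r - s ^ 2)
    (h4 : (4 : GaussianInt) ∣ D + 3 * r ^ 2 - 2 * s * (⟨1, 1⟩ * τ))
    (h8 : (8 : GaussianInt) ∣ D * r + r ^ 3 - 2 * gi * τ ^ 2) :
    D.re % 8 = 7 ∧ D.im % 4 = 2 := by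
  obtain ⟨hq, hpq⟩ := coords_of_primary hD
  have hπ : Prime (⟨1, 1⟩ : GaussianInt) := prime_one_add_i
  have hr : ¬ (⟨1, 1⟩ : GaussianInt) ∣ r := by
    intro hr
    refine odd_of_primary hD ?_
    have e : D = (D + 3 * r ^ 2 - 2 * s * (⟨1, 1⟩ * τ)) - 3 * r ^ 2 + 2 * s * (⟨1, 1⟩ * τ) := by
      ring
    rw [e]
    exact dvd_add (dvd_sub ((Dvd.intro ⟨2, -2⟩ (by decide)).trans h4)
      ((dvd_pow hr two_ne_zero).mul_left _)) ((dvd_mul_right _ _).mul_left _)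
  have hs : ¬ (⟨1, 1⟩ : GaussianInt) ∣ s := by
    intro hs
    have h3 : (⟨1, 1⟩ : GaussianInt) ∣ 3 * r := by
      have e : 3 * r = (3 * r - s ^ 2) + s ^ 2 := by ring
      rw [e]
      exact dvd_add ((Dvd.intro ⟨1, -1⟩ (by decide)).trans h2) (dvd_pow hs two_ne_zero)
    rcases hπ.dvd_or_dvd h3 with h | h
    · rw [one_add_i_dvd_iff] at h
      revert h
      decide
    · exact hr h
  have hw : ¬ (⟨1, 1⟩ : GaussianInt) ∣ s * τ := fun h =>
    (hπ.dvd_or_dvd h).elim hs hτ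
  rw [show 2 * s * (⟨1, 1⟩ * τ) = ⟨2, 2⟩ * (s * τ) by
    rw [show (⟨2, 2⟩ : GaussianInt) = 2 * ⟨1, 1⟩ by decide]; ring] at h4
  generalize s * τ = w at *
  rw [one_add_i_dvd_iff] at hw hr hτ
  obtain ⟨m, hm⟩ := h4
  have h4r := congrArg Zsqrtd.re hm
  have h4i := congrArg Zsqrtd.im hm
  obtain ⟨n, hn⟩ := h8
  have h8r := congrArg Zsqrtd.re hn
  simp only [pow_succ, pow_zero, one_mul, Zsqrtd.re_add, Zsqrtd.im_add, Zsqrtd.re_sub,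
    Zsqrtd.im_sub, Zsqrtd.re_mul, Zsqrtd.im_mul, Zsqrtd.re_ofNat, Zsqrtd.im_ofNat, gi]
    at h4r h4i h8r
  obtain ⟨p, q⟩ := D
  obtain ⟨a, b⟩ := r
  obtain ⟨c, d⟩ := τ
  simp only at *
  have hcd : c * d % 2 = 0 := by
    rcases Int.even_or_odd' c with ⟨x, rfl | rfl⟩
    · rw [mul_assoc]; omega
    · obtain ⟨y, rfl⟩ : ∃ y, d = 2 * y := ⟨d / 2, by omega⟩
      rw [mul_left_comm]; omega
  have hab : a * b % 2 = 0 := by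
    rcases Int.even_or_odd' a with ⟨x, rfl | rfl⟩
    · rw [mul_assoc]; omega
    · obtain ⟨y, rfl⟩ : ∃ y, b = 2 * y := ⟨b / 2, by omega⟩
      rw [mul_left_comm]; omega
  have hq4 : q % 4 = 2 := by
    ring_nf at h4i
    ring_nf at hab
    omega
  have hb : b % 2 = 0 := by
    by_contra hb
    obtain ⟨y, rfl⟩ : ∃ y, b = 2 * y + 1 := ⟨b / 2, by omega⟩
    obtain ⟨x, rfl⟩ : ∃ x, a = 2 * x := ⟨a / 2, by omega⟩
    ring_nf at h4r
    omega
  obtain ⟨y, rfl⟩ : ∃ y, b = 2 * y := ⟨b / 2, by omega⟩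
  obtain ⟨x, rfl⟩ : ∃ x, a = 2 * x + 1 := ⟨a / 2, by omega⟩
  obtain ⟨v, rfl⟩ : ∃ v, q = 4 * v + 2 := ⟨q / 4, by omega⟩
  obtain ⟨z, rfl⟩ : ∃ z, p = 4 * z + 3 := ⟨p / 4, by omega⟩
  have hx : (x ^ 2 + x) % 2 = 0 := by
    rcases Int.even_or_odd' x with ⟨e, rfl | rfl⟩ <;> ring_nf <;> omega
  have hy : (y ^ 2 + y) % 2 = 0 := by
    rcases Int.even_or_odd' y with ⟨e, rfl | rfl⟩ <;> ring_nf <;> omega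
  refine ⟨?_, hq4⟩
  ring_nf at h8r hx hy hcd
  omega

/-- A change of variables from the curve to a model with good reduction at `1 + i` is given by
`u = (1 + i) ε` for a unit `ε` and by integral `r`, `s`, `t`. -/
theorem exists_integral_change {D : GaussianInt} (hD : (⟨2, 2⟩ : GaussianInt) ∣ D - 1)
    {C : WeierstrassCurve.VariableChange K} {W : WeierstrassCurve (LocalRingAt placeTwo)}
    (hW : W.baseChange K = C • curve D) (hΔ : IsUnit W.Δ) :
    ∃ ε r s t : LocalRingAt placeTwo, IsUnit ε ∧
      (algebraMap GaussianInt (LocalRingAt placeTwo) ⟨1, 1⟩ * ε) ^ 2 * W.a₂ = 3 * r - s ^ 2 ∧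
      (algebraMap GaussianInt (LocalRingAt placeTwo) ⟨1, 1⟩ * ε) ^ 3 * W.a₃ = 2 * t ∧
      (algebraMap GaussianInt (LocalRingAt placeTwo) ⟨1, 1⟩ * ε) ^ 4 * W.a₄ =
        algebraMap GaussianInt (LocalRingAt placeTwo) D + 3 * r ^ 2 - 2 * s * t ∧
      (algebraMap GaussianInt (LocalRingAt placeTwo) ⟨1, 1⟩ * ε) ^ 6 * W.a₆ =
        algebraMap GaussianInt (LocalRingAt placeTwo) D * r + r ^ 3 - t ^ 2 := by
  set c := algebraMap (LocalRingAt placeTwo) K with hc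
  set am := algebraMap GaussianInt (LocalRingAt placeTwo) with ham
  have hcinj : Function.Injective c := FaithfulSMul.algebraMap_injective (LocalRingAt placeTwo) K
  have htower : ∀ g : GaussianInt, algebraMap GaussianInt K g = c (am g) := fun g => rfl
  have hcu : ∀ (n : ℕ) (x z : K), x = (↑C.u⁻¹ : K) ^ n * z → (C.u : K) ^ n * x = z := by
    rintro n x z rfl
    rw [← mul_assoc, ← mul_pow, Units.mul_inv, one_pow, one_mul]
  have e2 := hcu 2 _ _ (congrArg WeierstrassCurve.a₂ hW)
  have e3 := hcu 3 _ _ (congrArg WeierstrassCurve.a₃ hW)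
  have e4 := hcu 4 _ _ (congrArg WeierstrassCurve.a₄ hW)
  have e6 := hcu 6 _ _ (congrArg WeierstrassCurve.a₆ hW)
  have e8 := hcu 8 _ _ ((congrArg WeierstrassCurve.b₈ hW).trans
    (WeierstrassCurve.variableChange_b₈ _ _))
  have hb8 : (W.baseChange K).b₈ = c W.b₈ := W.map_b₈ _
  rw [hb8] at e8
  clear hb8
  generalize W.b₈ = β at e8
  simp only [WeierstrassCurve.baseChange, WeierstrassCurve.map_a₂,
    WeierstrassCurve.map_a₃, WeierstrassCurve.map_a₄, WeierstrassCurve.map_a₆, curve,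
    WeierstrassCurve.b₂, WeierstrassCurve.b₄, WeierstrassCurve.b₆, WeierstrassCurve.b₈,
    htower, ← hc] at e2 e3 e4 e6 e8
  set π := am ⟨1, 1⟩ with hπ
  set I := am gi with hI
  have hI2 : I ^ 2 = -1 := by rw [hI, ← map_pow, ← map_one am, ← map_neg]; congr 1
  have hπ2 : π ^ 2 = 2 * I := by
    rw [hI, hπ, ← map_pow, ← map_ofNat am 2, ← map_mul]; congr 1
  have hπ0 : π ≠ 0 := by
    rw [hπ, Ne, map_eq_zero_iff _ (algebraMap_localRing_injective placeTwo)]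
    exact prime_one_add_i.ne_zero
  have hcπ0 : c π ≠ 0 := (map_ne_zero_iff c hcinj).2 hπ0
  have hDval : placeTwo.valuation K (c (am D)) = 1 := by
    rw [← htower, HeightOneSpectrum.valuation_eq_one_iff_notMem, not_mem_placeTwo_iff]
    exact odd_of_primary hD
  have hπ12 : (-64 : LocalRingAt placeTwo) = π ^ 12 := by
    have : π ^ 12 = (π ^ 2) ^ 6 := by ring
    rw [this, hπ2]
    linear_combination (-64 * (I ^ 4 - I ^ 2 + 1)) * hI2
  -- The relation `u¹² Δ = -64 D³` together with `-64 = (1 + i)¹²` and `D` odd.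
  have hεval : placeTwo.valuation K (C.u / c π) = 1 := by
    have h := Δ_model hW
    have h' : ((C.u : K) / c π) ^ 12 * c W.Δ = c (am D) ^ 3 := by
      rw [div_pow, div_mul_eq_mul_div, div_eq_iff (pow_ne_zero _ hcπ0), ← map_pow c π, ← hπ12]
      rw [h, htower, map_neg, map_ofNat]
      ring
    have h'' := congrArg (placeTwo.valuation K) h'
    rw [map_mul, (isUnit_localRing_iff _).1 hΔ, mul_one, map_pow, map_pow, hDval, one_pow] at h''
    exact (pow_eq_one_iff_of_nonneg zero_le (by norm_num)).1 h''
  obtain ⟨ε, hε⟩ := exists_localRing_of_valuation_le hεval.le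
  rw [← hε, ← isUnit_localRing_iff] at hεval
  rw [← hc] at hε
  have hu : (C.u : K) = c (π * ε) := by rw [map_mul, hε, mul_div_cancel₀ _ hcπ0]
  have hlift : ∀ (n : ℕ) (x : K) (y : LocalRingAt placeTwo), n ≠ 0 → x ^ n = c y →
      ∃ z, c z = x := by
    intro n x y hn h
    refine exists_localRing_of_valuation_le ?_
    have h1 := valuation_localRing_le y
    rw [← hc, ← h, map_pow] at h1
    exact (pow_le_one_iff_of_nonneg zero_le hn).1 h1
  rw [hu] at e2 e3 e4 e6 e8
  obtain ⟨κ, hκ⟩ : ∃ κ : LocalRingAt placeTwo, 3 * κ = 1 := by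
    have h3 : IsUnit (am 3) := by
      rw [← IsLocalRing.notMem_maximalIdeal, algebraMap_mem_maximalIdeal_iff, one_add_i_dvd_iff]
      decide
    rw [map_ofNat] at h3
    exact h3.exists_right_inv
  -- The `b₈` relation `u⁸ b₈ = 3r⁴ + 6Dr² - D²` becomes `3(r² + D)² = 4D² + u⁸ b₈`, so `r² + D` is
  -- integral, and then `r`. The relations for `a₂` and `a₆` similarly give integral `s²` and `t²`.
  obtain ⟨r, hr⟩ : ∃ r, c r = C.r := by
    obtain ⟨y, hy⟩ := hlift 2 (C.r ^ 2 + c (am D))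
      (κ * (4 * am D ^ 2 + (π * ε) ^ 8 * β)) two_ne_zero (by
        have hκ' := congrArg c hκ
        simp only [map_mul, map_add, map_pow, map_ofNat, map_one] at e8 hκ' ⊢
        linear_combination (-c κ) * e8 - (C.r ^ 2 + c (am D)) ^ 2 * hκ')
    exact hlift 2 C.r (y - am D) two_ne_zero (by rw [map_sub, hy]; ring)
  obtain ⟨s, hs⟩ : ∃ s, c s = C.s :=
    hlift 2 C.s (3 * r - (π * ε) ^ 2 * W.a₂) two_ne_zero (by
      simp only [map_sub, map_mul, map_pow, map_ofNat, hr] at e2 ⊢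
      linear_combination e2)
  obtain ⟨t, ht⟩ : ∃ t, c t = C.t :=
    hlift 2 C.t (r ^ 3 + am D * r - (π * ε) ^ 6 * W.a₆) two_ne_zero (by
      simp only [map_sub, map_add, map_mul, map_pow, hr] at e6 ⊢
      linear_combination e6)
  rw [← hs] at e2 e4
  rw [← hr] at e2 e4 e6
  rw [← ht] at e3 e4 e6
  refine ⟨ε, r, s, t, hεval, ?_, ?_, ?_, ?_⟩ <;> apply hcinj
  · simp only [map_mul, map_sub, map_pow, map_ofNat] at e2 ⊢
    linear_combination e2
  · simp only [map_mul, map_pow, map_ofNat] at e3 ⊢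
    linear_combination e3
  · simp only [map_mul, map_sub, map_add, map_pow, map_ofNat] at e4 ⊢
    linear_combination e4
  · simp only [map_mul, map_sub, map_add, map_pow] at e6 ⊢
    linear_combination e6

theorem residue_two :
    (2 : IsLocalRing.ResidueField (LocalRingAt placeTwo)) = 0 := by
  have h := (IsLocalRing.residue_eq_zero_iff _).2
    ((algebraMap_mem_maximalIdeal_iff 2).2 ((one_add_i_dvd_iff _).2 (by decide)))
  rwa [map_ofNat, map_ofNat] at h

/-- The curve has `c₆ = 0`, so `c₄³ = 1728 Δ` vanishes in the residue field, while `c₄` reduces to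
`a₁⁴`. -/
theorem residue_a₁_of_model {D : GaussianInt} {C : WeierstrassCurve.VariableChange K}
    {W : WeierstrassCurve (LocalRingAt placeTwo)} (hW : W.baseChange K = C • curve D) :
    IsLocalRing.residue (LocalRingAt placeTwo) W.a₁ = 0 := by
  have hc6 : W.c₆ = 0 := by
    apply FaithfulSMul.algebraMap_injective (LocalRingAt placeTwo) K
    have h : (W.baseChange K).c₆ = algebraMap (LocalRingAt placeTwo) K W.c₆ := W.map_c₆ _
    rw [← h, hW, WeierstrassCurve.variableChange_c₆, map_zero]
    simp [curve, WeierstrassCurve.c₆, WeierstrassCurve.b₂, WeierstrassCurve.b₆]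
  have h := congrArg (IsLocalRing.residue (LocalRingAt placeTwo)) W.c_relation
  rw [hc6, zero_pow two_ne_zero, sub_zero, map_mul, map_ofNat, map_pow] at h
  have hc4 : IsLocalRing.residue (LocalRingAt placeTwo) W.c₄ = 0 := by
    refine pow_eq_zero_iff (n := 3) (by norm_num) |>.1 ?_
    rw [← h]
    linear_combination
      864 * IsLocalRing.residue (LocalRingAt placeTwo) W.Δ * residue_two
  refine pow_eq_zero_iff (n := 4) (by norm_num) |>.1 ?_
  simp only [WeierstrassCurve.c₄, WeierstrassCurve.b₂, map_sub, map_add, map_mul, map_pow,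
    map_ofNat] at hc4
  linear_combination hc4 -
    (4 * IsLocalRing.residue (LocalRingAt placeTwo) W.a₁ ^ 2 *
      IsLocalRing.residue (LocalRingAt placeTwo) W.a₂ +
      8 * IsLocalRing.residue (LocalRingAt placeTwo) W.a₂ ^ 2 -
      12 * IsLocalRing.residue (LocalRingAt placeTwo) W.b₄) * residue_two

/-- In characteristic 2 the discriminant vanishes when `a₁ = a₃ = 0`. -/
theorem residue_a₃_of_model {D : GaussianInt} {C : WeierstrassCurve.VariableChange K}
    {W : WeierstrassCurve (LocalRingAt placeTwo)} (hW : W.baseChange K = C • curve D)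
    (hΔ : IsUnit W.Δ) : IsLocalRing.residue (LocalRingAt placeTwo) W.a₃ = 1 := by
  refine (residue_eq_zero_or_one W.a₃).resolve_left fun h₃ => ?_
  set ρ := IsLocalRing.residue (LocalRingAt placeTwo)
  refine (hΔ.map ρ).ne_zero ?_
  simp only [WeierstrassCurve.Δ, WeierstrassCurve.b₂, WeierstrassCurve.b₆, map_add, map_sub,
    map_neg, map_mul, map_pow, map_ofNat, residue_a₁_of_model hW, h₃, ρ]
  linear_combination (-8 * ρ W.a₂ ^ 2 * ρ W.b₈ - 4 * ρ W.b₄ ^ 3 - 216 * ρ W.a₆ ^ 2 +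
    72 * ρ W.a₂ * ρ W.b₄ * ρ W.a₆) * residue_two

theorem coords_of_model {D : GaussianInt} (hD : (⟨2, 2⟩ : GaussianInt) ∣ D - 1)
    {C : WeierstrassCurve.VariableChange K} {W : WeierstrassCurve (LocalRingAt placeTwo)}
    (hW : W.baseChange K = C • curve D) (hΔ : IsUnit W.Δ) : D.re % 8 = 7 ∧ D.im % 4 = 2 := by
  obtain ⟨ε, r, s, t, hε, f2, f3, f4, f6⟩ := exists_integral_change hD hW hΔ
  set am := algebraMap GaussianInt (LocalRingAt placeTwo) with ham
  set π := am ⟨1, 1⟩ with hπ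
  set I := am gi with hI
  have hI2 : I ^ 2 = -1 := by rw [hI, ← map_pow, ← map_one am, ← map_neg]; congr 1
  have hπ2 : π ^ 2 = 2 * I := by
    rw [hI, hπ, ← map_pow, ← map_ofNat am 2, ← map_mul]; congr 1
  have hπ0 : π ≠ 0 := by
    rw [hπ, Ne, map_eq_zero_iff _ (algebraMap_localRing_injective placeTwo)]
    exact prime_one_add_i.ne_zero
  -- From `u³ a₃ = 2t` and `π² = 2I`; thus `t` is `1 + i` times a unit, and `t² = 2iτ²`.
  have g3 : t = π * (I * ε ^ 3 * W.a₃) := by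
    have h0 : π ^ 2 * (t - π * (I * ε ^ 3 * W.a₃)) = 0 := by
      linear_combination t * hπ2 - I * f3
    exact sub_eq_zero.1 ((mul_eq_zero.1 h0).resolve_left (pow_ne_zero 2 hπ0))
  set ρ := IsLocalRing.residue (LocalRingAt placeTwo) with hρ
  have hρ3 : ρ W.a₃ ≠ 0 := by rw [hρ, residue_a₃_of_model hW hΔ]; exact one_ne_zero
  set τ := I * ε ^ 3 * W.a₃ with hτ
  have hτ' : ρ τ ≠ 0 := by
    have hI0 : IsUnit I := IsUnit.of_mul_eq_one (-I) (by linear_combination -hI2)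
    rw [hτ, map_mul, map_mul, map_pow]
    exact mul_ne_zero (mul_ne_zero (hI0.map ρ).ne_zero
      (pow_ne_zero _ (hε.map ρ).ne_zero)) hρ3
  clear_value τ
  subst g3
  obtain ⟨r₀, r₁, rfl⟩ := exists_gaussianInt_congr r
  obtain ⟨s₀, s₁, rfl⟩ := exists_gaussianInt_congr s
  obtain ⟨τ₀, τ₁, rfl⟩ := exists_gaussianInt_congr τ
  have hπ4 : π ^ 4 = -4 := by linear_combination (π ^ 2 + 2 * I) * hπ2 + 4 * hI2
  have hπ6 : π ^ 6 = -8 * I := by linear_combination π ^ 2 * hπ4 - 4 * hπ2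
  refine coords_of_congruences (r := r₀) (s := s₀) (τ := τ₀) hD ?_
    (dvd_of_algebraMap_dvd ⟨4, by decide⟩ ?_) (dvd_of_algebraMap_dvd ⟨2, by decide⟩ ?_)
    (dvd_of_algebraMap_dvd dvd_rfl ?_)
  · rw [← algebraMap_mem_maximalIdeal_iff, ← IsLocalRing.residue_eq_zero_iff]
    intro h
    apply hτ'
    rw [map_add, h, map_mul, map_ofNat]
    linear_combination 4 * ρ τ₁ * residue_two
  · refine ⟨I * ε ^ 2 * W.a₂ - 12 * r₁ + 8 * am s₀ * s₁ + 32 * s₁ ^ 2, ?_⟩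
    simp only [map_sub, map_mul, map_pow, map_ofNat]
    linear_combination -f2 + ε ^ 2 * W.a₂ * hπ2
  · refine ⟨-ε ^ 4 * W.a₄ - 12 * am r₀ * r₁ - 48 * r₁ ^ 2 +
      4 * π * (am s₀ * τ₁ + s₁ * am τ₀) + 32 * π * s₁ * τ₁, ?_⟩
    simp only [map_sub, map_add, map_mul, map_pow, map_ofNat]
    linear_combination -f4 + ε ^ 4 * W.a₄ * hπ4
  · refine ⟨-I * ε ^ 6 * W.a₆ - am D * r₁ - 3 * am r₀ ^ 2 * r₁ - 24 * am r₀ * r₁ ^ 2 -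
      64 * r₁ ^ 3 + I * (4 * am τ₀ * τ₁ + 16 * τ₁ ^ 2), ?_⟩
    simp only [map_sub, map_add, map_mul, map_pow, map_ofNat]
    linear_combination -f6 + ε ^ 6 * W.a₆ * hπ6 + (am τ₀ + 8 * τ₁) ^ 2 * hπ2

/-! ### The Frobenius at `1 + i` -/

theorem conj_cmI (C : WeierstrassCurve.VariableChange K) :
    ((C * cmI * C⁻¹).u : K) = -algebraMap GaussianInt K gi ∧
      (C * cmI * C⁻¹).r = -2 * C.r * (↑C.u⁻¹ : K) ^ 2 ∧
      (C * cmI * C⁻¹).s = -(1 + algebraMap GaussianInt K gi) * C.s * (↑C.u⁻¹ : K) ∧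
      (C * cmI * C⁻¹).t = (2 * C.r * C.s + (algebraMap GaussianInt K gi - 1) * C.t) *
        (↑C.u⁻¹ : K) ^ 3 := by
  have hi : algebraMap GaussianInt K gi ^ 2 = -1 := by
    rw [← map_pow, ← map_one (algebraMap GaussianInt K), ← map_neg]; congr 1
  have hu : (cmI.u : K) = -algebraMap GaussianInt K gi := map_neg _ _
  have hr : cmI.r = 0 := rfl
  have hs : cmI.s = 0 := rfl
  have ht : cmI.t = 0 := rfl
  simp only [WeierstrassCurve.VariableChange.mul_def, WeierstrassCurve.VariableChange.inv_def,
    Units.val_mul, hu, hr, hs, ht]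
  set w : K := ↑C.u⁻¹
  refine ⟨?_, ?_, ?_, ?_⟩
  · rw [mul_right_comm, Units.mul_inv, one_mul]
  · linear_combination C.r * w ^ 2 * hi
  · ring
  · linear_combination (-algebraMap GaussianInt K gi * C.t * w ^ 3 - C.r * C.s * w ^ 3) * hi

section Residue

/-- An algebraic closure of the residue field at `1 + i`. -/
local notation "κ" => AlgebraicClosure (IsLocalRing.ResidueField (LocalRingAt placeTwo))

theorem algebraMap_residueClosure (x : LocalRingAt placeTwo) :
    algebraMap (LocalRingAt placeTwo) κ x =
      algebraMap (IsLocalRing.ResidueField (LocalRingAt placeTwo)) κ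
        (IsLocalRing.residue (LocalRingAt placeTwo) x) := rfl

instance : CharP κ 2 := by
  have h : (2 : κ) = 0 := by
    have h := congrArg (algebraMap (IsLocalRing.ResidueField (LocalRingAt placeTwo)) κ) residue_two
    rwa [map_ofNat, map_zero] at h
  exact CharTwo.of_one_ne_zero_of_two_eq_zero one_ne_zero h

theorem algebraMap_residueClosure_sq (x : LocalRingAt placeTwo) :
    algebraMap (LocalRingAt placeTwo) κ x ^ 2 = algebraMap (LocalRingAt placeTwo) κ x := by
  rw [algebraMap_residueClosure]
  rcases residue_eq_zero_or_one x with h | h <;> simp [h]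

theorem algebraMap_residueClosure_of_odd {g : GaussianInt} (hg : (g.re + g.im) % 2 = 1) :
    algebraMap (LocalRingAt placeTwo) κ (algebraMap GaussianInt (LocalRingAt placeTwo) g) = 1 := by
  have h : IsLocalRing.residue (LocalRingAt placeTwo)
      (algebraMap GaussianInt (LocalRingAt placeTwo) g) = 1 := by
    refine (residue_eq_zero_or_one _).resolve_left fun h => ?_
    rw [IsLocalRing.residue_eq_zero_iff, algebraMap_mem_maximalIdeal_iff, one_add_i_dvd_iff] at h
    omega
  rw [algebraMap_residueClosure, h, map_one]

theorem algebraMap_residueClosure_of_even {g : GaussianInt} (hg : (g.re + g.im) % 2 = 0) :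
    algebraMap (LocalRingAt placeTwo) κ (algebraMap GaussianInt (LocalRingAt placeTwo) g) = 0 := by
  rw [algebraMap_residueClosure, (IsLocalRing.residue_eq_zero_iff _).2
    ((algebraMap_mem_maximalIdeal_iff _).2 ((one_add_i_dvd_iff _).2 hg)), map_zero]

open WeierstrassCurve.Affine in
-- Stated for variables so that the substitutions pass through the dependent nonsingularity proofs.
theorem frobenius_relation_congr {k : Type*} [Field k] [DecidableEq k] {W : WeierstrassCurve.Affine k}
    {q : ℕ} {u r s t : k} (hq : q = 2) (hu : u = 1) (hr : r = 1) (hs : s = 1) (α : GaussianInt) :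
    (∀ (x y : k) (h : W.Nonsingular x y), ∃ (h₁ : W.Nonsingular (x ^ q) (y ^ q))
      (h₂ : W.Nonsingular (u ^ 2 * x + r) (u ^ 3 * y + u ^ 2 * s * x + t)),
        Point.some _ _ h₁ = α.re • Point.some _ _ h + α.im • Point.some _ _ h₂) ↔
    ∀ (x y : k) (h : W.Nonsingular x y), ∃ (h₁ : W.Nonsingular (x ^ 2) (y ^ 2))
      (h₂ : W.Nonsingular (x + 1) (y + x + t)),
        Point.some _ _ h₁ = α.re • Point.some _ _ h + α.im • Point.some _ _ h₂ := by
  subst hq hu hr hs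
  simp only [one_pow, one_mul]

theorem norm_eq_two_of_reducesToFrobenius {D : GaussianInt} {α : GaussianInt}
    (h : ReducesToFrobenius D placeTwo α) : α.norm = 2 := by
  classical
  obtain ⟨C, W, A, hW, hΔ, hA, h⟩ := h
  set ρ := IsLocalRing.residue (LocalRingAt placeTwo) with hρ
  have hinj : Function.Injective (algebraMap (LocalRingAt placeTwo) K) :=
    FaithfulSMul.algebraMap_injective _ _
  have hi : algebraMap GaussianInt K gi ^ 2 = -1 := by
    rw [← map_pow, ← map_one (algebraMap GaussianInt K), ← map_neg]; congr 1
  have ha₃ : algebraMap (LocalRingAt placeTwo) K W.a₃ = 2 * C.t * (↑C.u⁻¹ : K) ^ 3 := by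
    have h3 := congrArg WeierstrassCurve.a₃ hW
    rw [WeierstrassCurve.variableChange_a₃] at h3
    refine Eq.trans h3 ?_
    simp only [curve]
    ring
  obtain ⟨cu, cr, cs, ct⟩ := conj_cmI C
  rw [← hA] at cu cr cs ct
  -- Constant term of the `y`-coordinate in `[i]² = [-1]`. In the residue field it reads `r s = a₃ =
  -- 1`, which fixes `r = s = 1`.
  have hsq : A.t * (A.u : LocalRingAt placeTwo) ^ 3 + A.r * A.s * (A.u : LocalRingAt placeTwo) ^ 2 +
      A.t = -W.a₃ := by
    apply hinj
    have du : algebraMap (LocalRingAt placeTwo) K A.u = -algebraMap GaussianInt K gi := cu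
    have dr : algebraMap (LocalRingAt placeTwo) K A.r = _ := cr
    have ds : algebraMap (LocalRingAt placeTwo) K A.s = _ := cs
    have dt : algebraMap (LocalRingAt placeTwo) K A.t = _ := ct
    simp only [map_add, map_mul, map_pow, map_neg, du, dr, ds, dt, ha₃]
    set w : K := ↑C.u⁻¹
    set i := algebraMap GaussianInt K gi
    linear_combination w ^ 3 * (2 * C.r * C.s + (-i ^ 2 + i + 1) * C.t) * hi
  have hu : ρ (A.u : LocalRingAt placeTwo) = 1 :=
    (residue_eq_zero_or_one _).resolve_left (A.u.isUnit.map ρ).ne_zero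
  have hrs : ρ A.r * ρ A.s = 1 := by
    have h1 := congrArg ρ hsq
    have h3 : ρ W.a₃ = 1 := residue_a₃_of_model hW hΔ
    simp only [map_add, map_mul, map_pow, map_neg, hu, h3] at h1
    linear_combination h1 - (ρ A.t + 1) * residue_two
  have hr : ρ A.r = 1 := (residue_eq_zero_or_one _).resolve_left (left_ne_zero_of_mul_eq_one hrs)
  have hs : ρ A.s = 1 := (residue_eq_zero_or_one _).resolve_left (right_ne_zero_of_mul_eq_one hrs)
  have hmap : ∀ x, ρ x = 1 → algebraMap (LocalRingAt placeTwo) κ x = 1 := fun x hx => by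
    rw [algebraMap_residueClosure, ← hρ, hx, map_one]
  refine norm_eq_two_of_frobenius_eq (W := W) (k := κ) algebraMap_residueClosure_sq
    (by rw [algebraMap_residueClosure, residue_a₁_of_model hW, map_zero])
    (hmap _ (residue_a₃_of_model hW hΔ)) (algebraMap (LocalRingAt placeTwo) κ A.t) α ?_
  exact (frobenius_relation_congr placeNorm_placeTwo (hmap _ hu) (hmap _ hr) (hmap _ hs) α).1 h

/-- A model with good reduction at `1 + i`, from its coefficients in `ℤ[i]`. -/
theorem exists_reducesToFrobenius_of_model {D t a₃ a₄ a₆ tA : GaussianInt}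
    (hD : (⟨2, 2⟩ : GaussianInt) ∣ D - 1)
    (h3 : ⟨1, 1⟩ ^ 3 * a₃ = 2 * t) (h4 : ⟨1, 1⟩ ^ 4 * a₄ = D + 3 - 2 * t)
    (h6 : ⟨1, 1⟩ ^ 6 * a₆ = D + 1 - t ^ 2) (hA : ⟨1, 1⟩ ^ 3 * tA = 2 + (gi - 1) * t)
    (h3' : (a₃.re + a₃.im) % 2 = 1) (h4' : (a₄.re + a₄.im) % 2 = 0) :
    HasGoodReductionAt placeTwo (curve D) ∧ ∃ α, ReducesToFrobenius D placeTwo α := by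
  classical
  set am := algebraMap GaussianInt (LocalRingAt placeTwo) with ham
  set b := algebraMap GaussianInt K with hb
  have hbinj : Function.Injective b := FaithfulSMul.algebraMap_injective GaussianInt K
  have hP : b ⟨1, 1⟩ ≠ 0 := (map_ne_zero_iff b hbinj).2 prime_one_add_i.ne_zero
  -- Taking `u = 1 + i` and `r = s = 1` gives `a₁ = 2/u = 1 - i` and `a₂ = 2/u² = -i`. Conjugating
  -- `[i]` by `C` gives the entries of `A` below.
  let C : WeierstrassCurve.VariableChange K := ⟨Units.mk0 (b ⟨1, 1⟩) hP, 1, 1, b t⟩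
  let W : WeierstrassCurve (LocalRingAt placeTwo) :=
    ⟨am ⟨1, -1⟩, am (-gi), am a₃, am a₄, am a₆⟩
  let A : WeierstrassCurve.VariableChange (LocalRingAt placeTwo) :=
    ⟨Units.mkOfMulEqOne (am (-gi)) (am gi) (by
      rw [← map_mul, ← map_one am]; congr 1), am gi, am (-1), am tA⟩
  have hcu : ∀ (n : ℕ) (x z : K), b ⟨1, 1⟩ ^ n * x = z → x = (↑C.u⁻¹ : K) ^ n * z := by
    rintro n x z rfl
    have : (↑C.u⁻¹ : K) = (b ⟨1, 1⟩)⁻¹ := Units.val_inv_eq_inv_val _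
    rw [this, inv_pow, inv_mul_cancel_left₀ (pow_ne_zero _ hP)]
  have hW : W.baseChange K = C • curve D := by
    ext
    · refine (hcu 1 _ (2 * 1) ?_).trans (by
        rw [WeierstrassCurve.variableChange_a₁, pow_one]; simp [curve, C])
      change b ⟨1, 1⟩ ^ 1 * b ⟨1, -1⟩ = _
      rw [← map_pow, ← map_mul, ← map_one b, ← map_ofNat b 2, ← map_mul]
      congr 1
    · refine (hcu 2 _ (3 - 1) ?_).trans (by
        rw [WeierstrassCurve.variableChange_a₂]; simp [curve, C])
      change b ⟨1, 1⟩ ^ 2 * b (-gi) = _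
      rw [← map_pow, ← map_mul, ← map_one b, ← map_ofNat b 3, ← map_sub]
      congr 1
    · refine (hcu 3 _ (2 * b t) ?_).trans (by
        rw [WeierstrassCurve.variableChange_a₃]; simp [curve, C])
      change b ⟨1, 1⟩ ^ 3 * b a₃ = _
      rw [← map_pow, ← map_mul, ← map_ofNat b 2, ← map_mul, h3]
    · refine (hcu 4 _ (b D + 3 - 2 * b t) ?_).trans (by
        rw [WeierstrassCurve.variableChange_a₄]; simp [curve, C, hb])
      change b ⟨1, 1⟩ ^ 4 * b a₄ = _
      rw [← map_pow, ← map_mul, h4, map_sub, map_add, map_mul, map_ofNat, map_ofNat]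
    · refine (hcu 6 _ (b D + 1 - b t ^ 2) ?_).trans (by
        rw [WeierstrassCurve.variableChange_a₆]; simp [curve, C, hb])
      change b ⟨1, 1⟩ ^ 6 * b a₆ = _
      rw [← map_pow, ← map_mul, h6, map_sub, map_add, map_one, map_pow]
  have hΔ : IsUnit W.Δ := by
    have h := Δ_model hW
    have h64 : (-64 : K) = b ⟨1, 1⟩ ^ 12 := by
      rw [← map_pow, ← map_ofNat b 64, ← map_neg]; congr 1
    have hu : (C.u : K) = b ⟨1, 1⟩ := rfl
    rw [h64, hu] at h
    have h' := mul_left_cancel₀ (pow_ne_zero 12 hP) h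
    rw [isUnit_localRing_iff, h', map_pow,
      (HeightOneSpectrum.valuation_eq_one_iff_notMem _).2
        ((not_mem_placeTwo_iff _).2 (odd_of_primary hD)), one_pow]
  have hAK : A.baseChange K = C * cmI * C⁻¹ := by
    obtain ⟨cu, cr, cs, ct⟩ := conj_cmI C
    ext
    · rw [cu, ← map_neg]; rfl
    · rw [cr, mul_comm]
      refine hcu 2 _ _ ?_
      change b ⟨1, 1⟩ ^ 2 * b gi = -2 * 1
      rw [← map_pow, ← map_mul, mul_one, ← map_ofNat b 2, ← map_neg]
      congr 1
    · rw [cs, mul_comm, ← pow_one (↑C.u⁻¹ : K)]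
      refine hcu 1 _ _ ?_
      change b ⟨1, 1⟩ ^ 1 * b (-1) = -(1 + b gi) * 1
      rw [← map_pow, ← map_mul, mul_one, ← map_one b, ← map_add, ← map_neg]
      congr 1
    · rw [ct, mul_comm]
      refine hcu 3 _ _ ?_
      change b ⟨1, 1⟩ ^ 3 * b tA = 2 * 1 * 1 + (b gi - 1) * b t
      rw [← map_pow, ← map_mul, hA, map_add, map_mul, map_sub, map_one, map_ofNat]
      ring
  refine ⟨(hasGoodReductionAt_iff _ _).2 ⟨C, W, hW, hΔ⟩, ?_⟩
  have htA : algebraMap (LocalRingAt placeTwo) κ (am tA) = 0 ∨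
      algebraMap (LocalRingAt placeTwo) κ (am tA) = 1 := by
    rw [algebraMap_residueClosure]
    rcases residue_eq_zero_or_one (am tA) with h | h <;> simp [h]
  obtain ⟨α, hα⟩ := exists_frobenius_eq (W := W) (k := κ) algebraMap_residueClosure_sq
    (algebraMap_residueClosure_of_even (by decide)) (algebraMap_residueClosure_of_odd (by decide))
    (algebraMap_residueClosure_of_odd h3') (algebraMap_residueClosure_of_even h4') _ htA
  refine ⟨α, C, W, A, hW, hΔ, hAK, ?_⟩
  exact (frobenius_relation_congr placeNorm_placeTwo
    (algebraMap_residueClosure_of_odd (by decide)) (algebraMap_residueClosure_of_odd (by decide))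
    (algebraMap_residueClosure_of_odd (by decide)) α).2 hα

end Residue

/-- The value of `t` is chosen with `t² = ±2i`, so that `D + 1 - t² = 8δ` is divisible by `(1 + i)⁶
= -8i`; the other coefficients follow by division. -/
theorem exists_reducesToFrobenius {D : GaussianInt} (hD : (⟨2, 2⟩ : GaussianInt) ∣ D - 1)
    (hre : D.re % 8 = 7) (him : D.im % 4 = 2) :
    HasGoodReductionAt placeTwo (curve D) ∧ ∃ α, ReducesToFrobenius D placeTwo α := by
  obtain him' | him' : D.im % 8 = 2 ∨ D.im % 8 = 6 := by omega
  · obtain ⟨δ, hδ⟩ : ∃ δ : GaussianInt, D = ⟨-1, 2⟩ + 8 * δ :=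
      ⟨⟨(D.re + 1) / 8, (D.im - 2) / 8⟩, by ext <;> simp <;> omega⟩
    refine exists_reducesToFrobenius_of_model (t := ⟨1, 1⟩) (a₃ := -gi) (a₄ := -2 * δ)
      (a₆ := gi * δ) (tA := 0) hD (by decide) ?_ ?_ (by decide) (by decide) ?_
    · rw [hδ]
      ext <;> simp [pow_succ] <;> ring
    · rw [hδ]
      ext <;> simp [pow_succ, gi]
    · simp
  · obtain ⟨δ, hδ⟩ : ∃ δ : GaussianInt, D = ⟨-1, -2⟩ + 8 * δ :=
      ⟨⟨(D.re + 1) / 8, (D.im + 2) / 8⟩, by ext <;> simp <;> omega⟩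
    refine exists_reducesToFrobenius_of_model (t := ⟨-1, 1⟩) (a₃ := 1) (a₄ := ⟨-1, 1⟩ - 2 * δ)
      (a₆ := gi * δ) (tA := -1) hD (by decide) ?_ ?_ (by decide) (by decide) ?_
    · rw [hδ]
      ext <;> simp [pow_succ] <;> ring
    · rw [hδ]
      ext <;> simp [pow_succ, gi]
    · simp
      omega

theorem hasGoodReductionAt_placeTwo_iff {D : GaussianInt}
    (hD : (⟨2, 2⟩ : GaussianInt) ∣ D - 1) :
    HasGoodReductionAt placeTwo (curve D) ↔ quarticSymbol gi D = gi := by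
  rw [quarticSymbol_gi_eq_gi_iff hD]
  refine ⟨fun h => ?_, fun h => (exists_reducesToFrobenius hD h.1 h.2).1⟩
  obtain ⟨C, W, hW, hΔ⟩ := (hasGoodReductionAt_iff _ _).1 h
  exact coords_of_model hD hW hΔ

/-- Existence makes the choice in `heckeChar` a genuine Frobenius element; uniqueness is
unnecessary, since every candidate has norm 2. -/
theorem norm_heckeChar_placeTwo {D : GaussianInt} (hD : (⟨2, 2⟩ : GaussianInt) ∣ D - 1)
    (h : quarticSymbol gi D = gi) : (heckeChar D placeTwo).norm = 2 := by
  rw [heckeChar, if_pos ((hasGoodReductionAt_placeTwo_iff hD).2 h)]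
  rw [quarticSymbol_gi_eq_gi_iff hD] at h
  exact norm_eq_two_of_reducesToFrobenius
    (Classical.epsilon_spec (exists_reducesToFrobenius hD h.1 h.2).2)

/-! ### The Euler factors at the primes dividing `2 D` -/

theorem two_mem_iff (𝔭 : Place) : (2 : GaussianInt) ∈ 𝔭.asIdeal ↔ 𝔭 = placeTwo := by
  constructor
  · intro h
    have h1 : (⟨1, 1⟩ : GaussianInt) ∈ 𝔭.asIdeal := by
      have h2 : (⟨1, 1⟩ : GaussianInt) ^ 2 ∈ 𝔭.asIdeal := by
        rw [show (⟨1, 1⟩ : GaussianInt) ^ 2 = 2 * gi by decide]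
        exact Ideal.mul_mem_right _ _ h
      exact 𝔭.isPrime.mem_of_pow_mem 2 h2
    have hle : placeTwo.asIdeal ≤ 𝔭.asIdeal := (Ideal.span_singleton_le_iff_mem _).2 h1
    exact HeightOneSpectrum.ext
      (placeTwo.isMaximal.eq_of_le 𝔭.isPrime.ne_top hle).symm
  · rintro rfl
    exact Ideal.mem_span_singleton.2 ⟨⟨1, -1⟩, by decide⟩

theorem heckeLOmit_two (D : GaussianInt) (s : ℂ) :
    heckeLOmit 2 D s = heckeL D s * eulerFactor D placeTwo s := by
  rw [heckeLOmit]
  simp only [two_mem_iff, finprod_cond_eq_left]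

theorem eulerFactor_eq_one {D : GaussianInt} {𝔭 : Place}
    (h : ¬ HasGoodReductionAt 𝔭 (curve D)) (s : ℂ) : eulerFactor D 𝔭 s = 1 := by
  simp [eulerFactor, heckeChar, h]

theorem heckeLOmit_mul_self {g D : GaussianInt}
    (h : ∀ 𝔭 : Place, D ∈ 𝔭.asIdeal → ¬ HasGoodReductionAt 𝔭 (curve D)) (s : ℂ) :
    heckeLOmit (g * D) D s = heckeLOmit g D s := by
  rw [heckeLOmit, heckeLOmit]
  congr 1
  refine finprod_congr fun 𝔭 => ?_
  by_cases hg : g ∈ 𝔭.asIdeal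
  · simp [hg, Ideal.mul_mem_right D _ hg]
  · by_cases hD : D ∈ 𝔭.asIdeal
    · simp [eulerFactor_eq_one (h 𝔭 hD)]
    · have : g * D ∉ 𝔭.asIdeal := fun hm => (𝔭.isPrime.mem_or_mem hm).elim hg hD
      simp [hg, this]

/-! ### The `2`-adic valuation of the Euler factor at `1 + i` -/

theorem norm_two_padicComplex : ‖(2 : ℂ_[2])‖ = 1 / 2 := by
  have h : ‖algebraMap ℚ_[2] ℂ_[2] 2‖ = ‖(2 : ℚ_[2])‖ := norm_algebraMap' ℂ_[2] (2 : ℚ_[2])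
  rw [map_ofNat] at h
  have h2 := Padic.norm_p (p := 2)
  norm_num at h2
  rw [h, h2]

/-- With `z = bJ`, `(1 + z)² = 2z` gives `‖1 + z‖² = 1/2`. For `a = -1` the extra summand 2 is
strictly smaller, so the ultrametric inequality ignores it. -/
theorem sq_norm_two_sub {J : ℂ_[2]} (hJ : J ^ 2 = -1) {a b : ℤ} (ha : a = 1 ∨ a = -1)
    (hb : b = 1 ∨ b = -1) : ‖(2 - (a - b * J) : ℂ_[2])‖ ^ 2 = 1 / 2 := by
  have hJ1 : ‖J‖ = 1 := by
    have h := congrArg norm hJ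
    rw [norm_pow, norm_neg, norm_one] at h
    exact (pow_eq_one_iff_of_nonneg (norm_nonneg _) two_ne_zero).1 h
  have hbJ : ‖(b : ℂ_[2]) * J‖ = 1 := by
    rcases hb with rfl | rfl <;> simp [hJ1]
  have hbsq : ((b : ℂ_[2]) * J) ^ 2 = -1 := by
    rcases hb with rfl | rfl <;> simp [hJ]
  generalize (b : ℂ_[2]) * J = z at *
  have h1 : ‖1 + z‖ ^ 2 = 1 / 2 := by
    rw [← norm_pow, show (1 + z) ^ 2 = 2 * z by linear_combination hbsq, norm_mul, hbJ,
      norm_two_padicComplex, mul_one]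
  rcases ha with rfl | rfl
  · rw [← h1]
    congr 2
    push_cast
    ring
  · have hne : ‖(2 : ℂ_[2])‖ < ‖1 + z‖ := by
      rw [norm_two_padicComplex]
      nlinarith [norm_nonneg (1 + z)]
    have e : (2 - (((-1 : ℤ) : ℂ_[2]) - z)) = 2 + (1 + z) := by push_cast; ring
    rw [e, IsUltrametricDist.norm_add_eq_max_of_norm_ne_norm hne.ne, max_eq_right hne.le, h1]

theorem coords_of_norm_eq_two {α : GaussianInt} (h : α.norm = 2) :
    (α.re = 1 ∨ α.re = -1) ∧ (α.im = 1 ∨ α.im = -1) := by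
  replace h : α.re ^ 2 + α.im ^ 2 = 2 := by rw [← h, Zsqrtd.norm_def]; ring
  have hre := sq_nonneg α.re
  have him := sq_nonneg α.im
  have h1 : α.re ≤ 1 := by nlinarith
  have h2 : -1 ≤ α.re := by nlinarith
  have h3 : α.im ≤ 1 := by nlinarith
  have h4 : -1 ≤ α.im := by nlinarith
  generalize α.re = x at *
  generalize α.im = y at *
  interval_cases x <;> interval_cases y <;> simp_all

/-- Twice the factor is `2 - ψ̄`. Any embedding sends `I` to a square root of `-1`, so the result
does not depend on `ι`. -/
theorem sq_norm_eulerFactor_placeTwo {D : GaussianInt} (h : (heckeChar D placeTwo).norm = 2)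
    (ι : ℂ →+* ℂ_[2]) : ‖ι (eulerFactor D placeTwo 1)‖ ^ 2 = 2 := by
  obtain ⟨ha, hb⟩ := coords_of_norm_eq_two h
  have hJ : ι Complex.I ^ 2 = -1 := by rw [← map_pow, Complex.I_sq, map_neg, map_one]
  have he : ι (eulerFactor D placeTwo 1) * 2 =
      2 - (((heckeChar D placeTwo).re : ℂ_[2]) - (heckeChar D placeTwo).im * ι Complex.I) := by
    have hC : eulerFactor D placeTwo 1 * 2 =
        2 - (((heckeChar D placeTwo).re : ℂ) - (heckeChar D placeTwo).im * Complex.I) := by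
      rw [eulerFactor, placeNorm_placeTwo, Complex.cpow_neg_one, GaussianInt.toComplex_def]
      simp only [map_add, map_mul, Complex.conj_I, map_intCast]
      push_cast
      ring
    have h' := congrArg ι hC
    simpa only [map_mul, map_sub, map_ofNat, map_intCast] using h'
  have hn := sq_norm_two_sub hJ ha hb
  rw [← he, norm_mul, norm_two_padicComplex, mul_pow] at hn
  linarith

theorem v2_mul_of_sq_norm_eq_two {x y : ℂ_[2]} (hy : ‖y‖ ^ 2 = 2) :
    v2 (x * y) = v2 x - ((1 / 2 : ℝ) : EReal) := by
  have hy0 : ‖y‖ ≠ 0 := fun h => by simp [h] at hy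
  have hy1 : y ≠ 0 := fun h => hy0 (by simp [h])
  by_cases hx : x = 0
  -- Here both sides are `⊤`, as `⊤ - 1/2 = ⊤`; nonvanishing of the `L`-value is not needed.
  · simp [v2, hx]
  · have hlog : Real.logb 2 ‖y‖ = 1 / 2 := by
      have h := congrArg (Real.logb 2) hy
      rw [Real.logb_pow, Real.logb_self_eq_one (by norm_num)] at h
      push_cast at h
      linarith
    rw [v2, v2, if_neg (mul_ne_zero hx hy1), if_neg hx, ← EReal.coe_sub, norm_mul,
      Real.logb_mul (norm_ne_zero_iff.2 hx) hy0, hlog]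
    congr 1
    ring

end GaussCurve

theorem mainTheorem5 (D : GaussianInt) (hD : (⟨2, 2⟩ : GaussianInt) ∣ D - 1)
    (hfree : ∀ π : GaussianInt, Prime π → ¬ π ^ 4 ∣ D) :
    (∀ 𝔭 : GaussCurve.Place, D ∈ 𝔭.asIdeal →
      ¬ GaussCurve.HasGoodReductionAt 𝔭 (GaussCurve.curve D)) ∧
    (GaussCurve.HasGoodReductionAt GaussCurve.placeTwo (GaussCurve.curve D) ↔
      GaussCurve.quarticSymbol GaussCurve.gi D = GaussCurve.gi) ∧
    ∀ ι : ℂ →+* ℂ_[2],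
      GaussCurve.v2 (ι (GaussCurve.heckeLOmit (2 * D) D 1 / (GaussCurve.Omega : ℂ))) =
        GaussCurve.v2 (ι (GaussCurve.heckeLOmit 2 D 1 / (GaussCurve.Omega : ℂ))) ∧
      (GaussCurve.quarticSymbol GaussCurve.gi D = GaussCurve.gi →
        GaussCurve.v2 (ι (GaussCurve.heckeLOmit 2 D 1 / (GaussCurve.Omega : ℂ))) =
          GaussCurve.v2 (ι (GaussCurve.heckeL D 1 / (GaussCurve.Omega : ℂ))) -
            ((1 / 2 : ℝ) : EReal)) ∧
      (GaussCurve.quarticSymbol GaussCurve.gi D ≠ GaussCurve.gi →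
        GaussCurve.v2 (ι (GaussCurve.heckeLOmit 2 D 1 / (GaussCurve.Omega : ℂ))) =
          GaussCurve.v2 (ι (GaussCurve.heckeL D 1 / (GaussCurve.Omega : ℂ)))) := by

  have hbad : ∀ 𝔭 : GaussCurve.Place, D ∈ 𝔭.asIdeal →
      ¬ GaussCurve.HasGoodReductionAt 𝔭 (GaussCurve.curve D) := fun _ h =>
    GaussCurve.not_hasGoodReductionAt_of_mem hD hfree h
  have hgood := GaussCurve.hasGoodReductionAt_placeTwo_iff hD
  refine ⟨hbad, hgood, fun ι => ⟨?_, fun h => ?_, fun h => ?_⟩⟩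
  · rw [GaussCurve.heckeLOmit_mul_self hbad]
  · rw [GaussCurve.heckeLOmit_two, mul_div_right_comm, map_mul]
    exact GaussCurve.v2_mul_of_sq_norm_eq_two (GaussCurve.sq_norm_eulerFactor_placeTwo
      (GaussCurve.norm_heckeChar_placeTwo hD h) ι)
  · rw [GaussCurve.heckeLOmit_two, GaussCurve.eulerFactor_eq_one (mt hgood.1 h), mul_one]
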